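/- A two-qubit state is a positive semidefinite operator $\rho$ of trace one on $\mathbb C^2\otimes\mathbb C^2$. Its fidelity is $F(\rho)=\max_\psi\langle\psi|\rho|\psi\rangle$, the maximum being over all maximally entangled unit vectors $\psi$ (those whose reduced one-qubit state is $I/2$). Its negativity is $N(\rho)=\max(0,-2\lambda_{\min}(\rho^\Gamma))$, where $\rho^\Gamma$ is the partial transpose of $\rho$ and $\lambda_{\min}$ denotes the smallest eigenvalue. Its concurrence is $C(\rho)=\max(0,\lambda_1-\lambda_2-\lambda_3-\lambda_4)$, where $\lambda_1\ge\lambda_2\ge\lambda_3\ge\lambda_4\ge0$ are the square roots of the eigenvalues of $\rho\,(\sigma_y\otimes\sigma_y)\rho^*(\sigma_y\otimes\sigma_y)$; here $\rho^*$ is the complex conjugate of $\rho$ in the standard product basis and $\sigma_y$ is the Pauli matrix. For $0\le C\le 1/3$ let $\rho_C$, and for $1/3\le C\le1$ let $\rho'_C$, be given in the basis $|00\rangle,|01\rangle,|10\rangle,|11\rangle$ by $$\rho_C=\begin{pmatrix}\frac{1+C}{2}&0&0&0\\0&\frac{1-C+\sqrt{1-2C-3C^2}}{4}&-\frac C2&0\\0&-\frac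 C2&\frac{1-C-\sqrt{1-2C-3C^2}}{4}&0\\0&0&0&0\end{pmatrix},\qquad \rho'_C=\begin{pmatrix}1-C&0&0&0\\0&\frac C2&-\frac C2&0\\0&-\frac C2&\frac C2&0\\0&0&0&0\end{pmatrix}.$$ 1. Every two-qubit state with negativity $N$ and fidelity $F$ satisfies $$F\ge\tfrac14+\tfrac18\left(N+\sqrt{5N^2+4N}\right)\ \text{ if } N\le\tfrac{\sqrt5-2}{3},\qquad F\ge\sqrt{2N(N+1)}-N\ \text{ if } N\ge\tfrac{\sqrt5-2}{3},$$ and in all cases $F\le\frac{1+N}{2}$. 2. All three bounds are sharp. For every $N\in[0,\frac{\sqrt5-2}{3}]$ the first is attained by some $\rho_C$, $0\le C\le\frac13$, of negativity $N$; for every $N\in[\frac{\sqrt5-2}{3},1]$ the second is attained by some $\rho'_C$, $\frac13\le C\le1$, of negativity $N$; and for every $N\in[0,1]$ the upper bound is attained by some state of negativity $N$. 3. Exactly the same states minimize the fidelity for given negativity and for given concurrence: a state has the least fidelity among all states with the same negativity if and only if it has the least fidelity among all states with the same concurrence. Moreover, for all $2\times2$ unitary matrices $U,V$, the states $(U\otimes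 V)\rho_C(U\otimes V)^\dagger$ with $0\le C\le\frac13$ and $(U\otimes V)\rho'_C(U\otimes V)^\dagger$ with $\frac13\le C\le1$ are states of concurrence $C$ that have both properties. -/

import Mathlib

open scoped Kronecker Matrix ComplexOrder

noncomputable section

/-- Operators on two qubits, in the computational product basis `|ij⟩`, `i, j ∈ {0, 1}`. -/
abbrev TwoQubitOp := Matrix (Fin 2 × Fin 2) (Fin 2 × Fin 2) ℂ

/-- A (mixed) two-qubit state: a positive semidefinite operator of trace one. -/
def IsState (ρ : TwoQubitOp) : Prop := ρ.PosSemidef ∧ ρ.trace = 1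

/-- The reduced density matrix on the first qubit of the vector `∑ ψ (i, j) |ij⟩`. -/
def reducedDensity (ψ : Fin 2 × Fin 2 → ℂ) : Matrix (Fin 2) (Fin 2) ℂ :=
  Matrix.of fun i k => ∑ j, ψ (i, j) * star (ψ (k, j))

/-- A vector is a (normalised) maximally entangled pure state when its reduced state is the
maximally mixed qubit state `I / 2`. -/
def IsMaximallyEntangled (ψ : Fin 2 × Fin 2 → ℂ) : Prop :=
  reducedDensity ψ = (1 / 2 : ℂ) • (1 : Matrix (Fin 2) (Fin 2) ℂ)

/-- The overlap `⟨ψ|ρ|ψ⟩` (a real number when `ρ` is Hermitian). -/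
def overlap (ρ : TwoQubitOp) (ψ : Fin 2 × Fin 2 → ℂ) : ℝ := (star ψ ⬝ᵥ (ρ *ᵥ ψ)).re

/-- The fidelity (maximal singlet fraction): the maximal overlap with a maximally entangled
pure state. The set of these overlaps is nonempty and compact, so the supremum is a maximum. -/
def fidelity (ρ : TwoQubitOp) : ℝ :=
  sSup {x : ℝ | ∃ ψ, IsMaximallyEntangled ψ ∧ x = overlap ρ ψ}

/-- The partial transpose `ρ^Γ` with respect to the second qubit. -/
def partialTranspose (ρ : TwoQubitOp) : TwoQubitOp :=
  Matrix.of fun p q => ρ (p.1, q.2) (q.1, p.2)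

/-- The smallest real eigenvalue; used for Hermitian matrices, all of whose eigenvalues are
real. -/
def minEigenvalue (A : TwoQubitOp) : ℝ := sInf (spectrum ℝ A)

/-- The negativity `max (0, -2 λ_min (ρ^Γ))`. -/
def negativity (ρ : TwoQubitOp) : ℝ := max 0 (-2 * minEigenvalue (partialTranspose ρ))

/-- The Pauli matrix `σ_y`. -/
def pauliY : Matrix (Fin 2) (Fin 2) ℂ := !![0, -Complex.I; Complex.I, 0]

/-- The spin-flipped operator `(σ_y ⊗ σ_y) ρ* (σ_y ⊗ σ_y)`, where `ρ*` is the entrywise complex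
conjugate in the computational basis. -/
def spinFlip (ρ : TwoQubitOp) : TwoQubitOp :=
  (pauliY ⊗ₖ pauliY) * ρ.map star * (pauliY ⊗ₖ pauliY)

/-- The four square roots of the eigenvalues of `ρ * spinFlip ρ`, with multiplicity. For a state
these eigenvalues are real and nonnegative. -/
def woottersValues (ρ : TwoQubitOp) : Multiset ℝ :=
  (ρ * spinFlip ρ).charpoly.roots.map fun z => Real.sqrt z.re

/-- The (Wootters) concurrence `max (0, λ₁ - λ₂ - λ₃ - λ₄)`, where `λ₁ ≥ λ₂ ≥ λ₃ ≥ λ₄ ≥ 0` are the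
numbers of `woottersValues`; note that `λ₁ - λ₂ - λ₃ - λ₄` is twice the largest of them minus
their sum. -/
def concurrence (ρ : TwoQubitOp) : ℝ :=
  max 0 (2 * (woottersValues ρ).fold max 0 - (woottersValues ρ).sum)

/-- `ρ` has the least fidelity among all states with the same negativity. -/
def MinimizesFidelityForNegativity (ρ : TwoQubitOp) : Prop :=
  IsState ρ ∧ ∀ σ, IsState σ → negativity σ = negativity ρ → fidelity ρ ≤ fidelity σ

/-- `ρ` has the least fidelity among all states with the same concurrence. -/
def MinimizesFidelityForConcurrence (ρ : TwoQubitOp) : Prop :=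
  IsState ρ ∧ ∀ σ, IsState σ → concurrence σ = concurrence ρ → fidelity ρ ≤ fidelity σ

/-- The operator with the given real matrix in the basis `|00⟩, |01⟩, |10⟩, |11⟩`. -/
def ofRealMatrix (M : Matrix (Fin 4) (Fin 4) ℝ) : TwoQubitOp :=
  Matrix.of fun p q => ((M (finProdFinEquiv p) (finProdFinEquiv q) : ℝ) : ℂ)

/-- The family of states for concurrence `0 ≤ C ≤ 1/3`. -/
def lowFamily (C : ℝ) : TwoQubitOp :=
  ofRealMatrix
    !![(1 + C) / 2, 0, 0, 0;
       0, (1 - C + Real.sqrt (1 - 2 * C - 3 * C ^ 2)) / 4, -C / 2, 0;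
       0, -C / 2, (1 - C - Real.sqrt (1 - 2 * C - 3 * C ^ 2)) / 4, 0;
       0, 0, 0, 0]

/-- The family of states for concurrence `1/3 ≤ C ≤ 1`. -/
def highFamily (C : ℝ) : TwoQubitOp :=
  ofRealMatrix
    !![1 - C, 0, 0, 0;
       0, C / 2, -C / 2, 0;
       0, -C / 2, C / 2, 0;
       0, 0, 0, 0]

/-- Conjugation by the local unitary `U ⊗ V`. -/
def localConj (U V : Matrix.unitaryGroup (Fin 2) ℂ) (ρ : TwoQubitOp) : TwoQubitOp :=
  ((U : Matrix (Fin 2) (Fin 2) ℂ) ⊗ₖ (V : Matrix (Fin 2) (Fin 2) ℂ)) * ρ *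
    ((U : Matrix (Fin 2) (Fin 2) ℂ) ⊗ₖ (V : Matrix (Fin 2) (Fin 2) ℂ))ᴴ

end

/-!
Everything is read off from the entries of a state in product bases. For a state `ρ` in some
product basis let `p`, `q` be the populations of `00` and `11` and `y` twice the modulus of the
coherence between `01` and `10`. Positivity gives `y ≤ 1 - p - q`, and testing the fidelity `F` on
`|01⟩ + w |10⟩` and `|00⟩ ± |11⟩` gives `(1 - p - q + y) / 2 ≤ F` and `(p + q) / 2 ≤ F`. Since `F` does
not change under local unitaries, this holds in every product basis. The two entanglement measures
are, when positive, extremal values over all product bases: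

* the negativity `N` is the least number with `y ^ 2 ≤ (N + 2 p) (N + 2 q)` in every product basis
  (`coherence_sq_le_negativity`), and equality holds in the Schmidt basis of an eigenvector of
  `ρ^Γ` (`exists_localConj_negativity_le`);
* the concurrence `C` is the maximum of `y - 2 √(p q)`
  (`two_mul_coherence_localConj_le_concurrence`, `exists_localConj_concurrence_le`).

The lower bounds on `F` follow by elementary inequalities in the basis where the measure is attained
(`negativityBound_le_fidelity`, `concurrenceBound_le_fidelity`). Equality in either bound
determines `p`, `q` and `y` in that basis; inserting these values into the inequality for the other
measure shows that the other bound is an equality as well (`fidelity_eq_negativityBound_iff`). The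
upper bound holds because the partial transpose of a maximally entangled projector is
`1 / 2 - |φ⟩⟨φ|`.

The formula for the concurrence rests on Takagi decompositions `ρ = ∑ₖ |xₖ⟩⟨xₖ|`, for which the matrix
of spin-flip overlaps is diagonal with entries `l₀ ≥ l₁, l₂, l₃ ≥ 0`; then
`C = max (0, l₀ - l₁ - l₂ - l₃)`. Mixing the `xₖ` by a suitable unitary distributes the concurrence
evenly, which bounds every `y - 2 √(p q)`. Conversely, if all `lₖ` are positive, the `2 × 2` matrices
of the `xₖ` are, up to a common left factor and scaling, the identity and a triple multiplying like
the quaternion units. An inner product invariant under this quaternion group yields a vector `φ` with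
`⟨φ|ρ^Γ|φ⟩ = -|det φ| (l₀ - l₁ - l₂ - l₃)`, and its Schmidt basis is the basis sought. A
compactness argument covers states of lower rank.
-/

/-! ### Smallest eigenvalue and negativity -/

theorem quadraticForm_eq_sum (A : TwoQubitOp) (φ : Fin 2 × Fin 2 → ℂ) :
    star φ ⬝ᵥ (A *ᵥ φ) = ∑ p, ∑ q, star (φ p) * A p q * φ q := by
  simp [dotProduct, Matrix.mulVec, Finset.mul_sum, mul_assoc]

theorem minEigenvalue_le_of_mem_spectrum {A : TwoQubitOp} (hA : A.IsHermitian) {x : ℝ}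
    (hx : x ∈ spectrum ℝ A) : minEigenvalue A ≤ x := by
  refine csInf_le ?_ hx
  rw [hA.spectrum_real_eq_range_eigenvalues]
  exact (Set.finite_range _).bddBelow

theorem posSemidef_sub_minEigenvalue {A : TwoQubitOp} (hA : A.IsHermitian) :
    (A - algebraMap ℝ TwoQubitOp (minEigenvalue A)).PosSemidef := by
  have hB : (A - algebraMap ℝ TwoQubitOp (minEigenvalue A)).IsHermitian := by
    refine hA.sub ?_
    rw [Matrix.algebraMap_eq_diagonal]
    exact Matrix.isHermitian_diagonal_of_self_adjoint _ (by ext; simp)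
  refine (hB.posSemidef_iff_eigenvalues_nonneg).2 fun i => ?_
  have h := hB.eigenvalues_mem_spectrum_real i
  have h2 : hB.eigenvalues i + minEigenvalue A ∈ spectrum ℝ A := by
    have := (spectrum.add_mem_add_iff (s := minEigenvalue A)).2 h
    simpa [add_comm] using this
  have := minEigenvalue_le_of_mem_spectrum hA h2
  simpa using this

theorem exists_eigenvector_minEigenvalue {A : TwoQubitOp} (hA : A.IsHermitian) :
    ∃ φ : Fin 2 × Fin 2 → ℂ, (∑ p, ‖φ p‖ ^ 2 = 1) ∧
      (star φ ⬝ᵥ (A *ᵥ φ)).re = minEigenvalue A := by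
  have hmem : minEigenvalue A ∈ Set.range hA.eigenvalues := by
    unfold minEigenvalue
    rw [hA.spectrum_real_eq_range_eigenvalues]
    exact (Set.range_nonempty _).csInf_mem (Set.finite_range _)
  obtain ⟨i, hi⟩ := hmem
  refine ⟨hA.eigenvectorBasis i, ?_, ?_⟩
  · have := hA.eigenvectorBasis.orthonormal.1 i
    rw [← EuclideanSpace.norm_sq_eq, this, one_pow]
  · rw [← hi, hA.eigenvalues_eq]; rfl

theorem isHermitian_partialTranspose {ρ : TwoQubitOp} (h : ρ.IsHermitian) :
    (partialTranspose ρ).IsHermitian := by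
  ext p q
  simpa [partialTranspose] using h.apply (p.1, q.2) (q.1, p.2)

theorem negativity_nonneg (ρ : TwoQubitOp) : 0 ≤ negativity ρ := le_max_left _ _

/-- The negativity is the least shift that makes the partial transpose positive (up to the
factor `1 / 2`). -/
theorem posSemidef_partialTranspose_add {ρ : TwoQubitOp} (h : ρ.IsHermitian) :
    (partialTranspose ρ + ((negativity ρ / 2 : ℝ) : ℂ) • (1 : TwoQubitOp)).PosSemidef := by
  have h1 := posSemidef_sub_minEigenvalue (isHermitian_partialTranspose h)
  set m := minEigenvalue (partialTranspose ρ)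
  have hN : 0 ≤ negativity ρ / 2 + m := by
    have : -2 * m ≤ negativity ρ := le_max_right _ _
    linarith
  have h2 : (((negativity ρ / 2 + m : ℝ) : ℂ) • (1 : TwoQubitOp)).PosSemidef :=
    Matrix.PosSemidef.one.smul (by exact_mod_cast hN)
  convert h1.add h2 using 1
  rw [Matrix.algebraMap_eq_diagonal]
  ext p q
  by_cases hpq : p = q <;> simp [hpq]

/-! ### Local unitary transformations -/

theorem localConj_apply (U V : Matrix.unitaryGroup (Fin 2) ℂ) (ρ : TwoQubitOp)
    (i j k l : Fin 2) :
    localConj U V ρ (i, j) (k, l) = ∑ a, ∑ b, ∑ c, ∑ d,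
      U.1 i a * V.1 j b * ρ (a, b) (c, d) * star (U.1 k c) * star (V.1 l d) := by
  simp only [localConj, Matrix.mul_apply, Matrix.conjTranspose_apply, Fintype.sum_prod_type,
    Matrix.kroneckerMap_apply, Finset.sum_mul, star_mul']
  rw [Finset.sum_comm_cycle]
  simp only [Fin.sum_univ_two]
  ring

theorem localConj_mul (U V U' V' : Matrix.unitaryGroup (Fin 2) ℂ) (ρ : TwoQubitOp) :
    localConj U V (localConj U' V' ρ) = localConj (U * U') (V * V') ρ := by
  simp only [localConj, Submonoid.coe_mul, Matrix.mul_kronecker_mul, Matrix.conjTranspose_mul,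
    Matrix.mul_assoc]

theorem localConj_one (ρ : TwoQubitOp) : localConj 1 1 ρ = ρ := by
  simp [localConj]

theorem kronecker_conjTranspose_mul_self (U V : Matrix.unitaryGroup (Fin 2) ℂ) :
    (U.1 ⊗ₖ V.1)ᴴ * (U.1 ⊗ₖ V.1) = 1 := by
  have hU : U.1ᴴ * U.1 = 1 := Matrix.mem_unitaryGroup_iff'.1 U.2
  have hV : V.1ᴴ * V.1 = 1 := Matrix.mem_unitaryGroup_iff'.1 V.2
  rw [Matrix.conjTranspose_kronecker, ← Matrix.mul_kronecker_mul, hU, hV,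
    Matrix.one_kronecker_one]

theorem trace_localConj (U V : Matrix.unitaryGroup (Fin 2) ℂ) (ρ : TwoQubitOp) :
    (localConj U V ρ).trace = ρ.trace := by
  rw [localConj, Matrix.trace_mul_cycle, kronecker_conjTranspose_mul_self, Matrix.one_mul]

theorem IsState.localConj {ρ : TwoQubitOp} (h : IsState ρ) (U V : Matrix.unitaryGroup (Fin 2) ℂ) :
    IsState (localConj U V ρ) :=
  ⟨h.1.mul_mul_conjTranspose_same _, by rw [trace_localConj, h.2]⟩

/-- The entrywise complex conjugate of a unitary matrix. -/
def conjUnitary (U : Matrix.unitaryGroup (Fin 2) ℂ) : Matrix.unitaryGroup (Fin 2) ℂ :=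
  ⟨U.1.map star, by
    have h : U.1 * U.1ᴴ = 1 := Matrix.mem_unitaryGroup_iff.1 U.2
    rw [Matrix.mem_unitaryGroup_iff, Matrix.star_eq_conjTranspose]
    ext i j
    have := congrArg star (congrFun (congrFun h i) j)
    simpa [Matrix.mul_apply, Matrix.one_apply, apply_ite] using this⟩

theorem partialTranspose_localConj (U V : Matrix.unitaryGroup (Fin 2) ℂ) (ρ : TwoQubitOp) :
    partialTranspose (localConj U V ρ) = localConj U (conjUnitary V) (partialTranspose ρ) := by
  ext ⟨i, j⟩ ⟨k, l⟩
  simp only [partialTranspose, Matrix.of_apply, localConj_apply, conjUnitary, Matrix.map_apply,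
    Fin.sum_univ_two, star_star]
  ring

/-! ### The Schmidt decomposition -/

theorem mem_unitaryGroup_of_unit_vector {u v : ℂ} (h : ‖u‖ ^ 2 + ‖v‖ ^ 2 = 1) :
    !![u, -star v; v, star u] ∈ Matrix.unitaryGroup (Fin 2) ℂ := by
  have h' : star u * u + star v * v = 1 := by
    simp only [Complex.star_def, ← Complex.normSq_eq_conj_mul_self, Complex.normSq_eq_norm_sq]
    exact_mod_cast h
  rw [Matrix.mem_unitaryGroup_iff']
  ext i j
  fin_cases i <;> fin_cases j <;>
    simp [Matrix.mul_apply, Fin.sum_univ_two, Matrix.star_apply] <;>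
    simp at h' <;> first | linear_combination h' | ring

theorem exists_unit_vector_parallel_orthogonal {a b c d : ℂ} (h : star a * b + star c * d = 0) :
    ∃ u v : ℂ, ‖u‖ ^ 2 + ‖v‖ ^ 2 = 1 ∧ u * c = v * a ∧ star u * b + star v * d = 0 := by
  by_cases hac : a = 0 ∧ c = 0
  · obtain ⟨rfl, rfl⟩ := hac
    by_cases hbd : b = 0 ∧ d = 0
    · obtain ⟨rfl, rfl⟩ := hbd
      exact ⟨1, 0, by simp, by simp, by simp⟩
    · have hr : 0 < ‖b‖ ^ 2 + ‖d‖ ^ 2 := by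
        rcases not_and_or.1 hbd with h | h <;> have := norm_pos_iff.2 h <;> positivity
      have hs := Real.sq_sqrt hr.le
      have hs0 : 0 < √(‖b‖ ^ 2 + ‖d‖ ^ 2) := Real.sqrt_pos.2 hr
      refine ⟨-star d / (√(‖b‖ ^ 2 + ‖d‖ ^ 2) : ℝ), star b / (√(‖b‖ ^ 2 + ‖d‖ ^ 2) : ℝ), ?_, ?_, ?_⟩
      · simp only [norm_div, norm_neg, norm_star, Complex.norm_real, div_pow, Real.norm_eq_abs,
          sq_abs, hs]
        field_simp
        ring
      · simp
      · simp
        ring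
  · have hr : 0 < ‖a‖ ^ 2 + ‖c‖ ^ 2 := by
      rcases not_and_or.1 hac with h | h <;> have := norm_pos_iff.2 h <;> positivity
    have hs := Real.sq_sqrt hr.le
    have hs0 : 0 < √(‖a‖ ^ 2 + ‖c‖ ^ 2) := Real.sqrt_pos.2 hr
    refine ⟨a / (√(‖a‖ ^ 2 + ‖c‖ ^ 2) : ℝ), c / (√(‖a‖ ^ 2 + ‖c‖ ^ 2) : ℝ), ?_, by ring, ?_⟩
    · simp only [norm_div, Complex.norm_real, div_pow, Real.norm_eq_abs,
        sq_abs, hs]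
      field_simp
    · simp at h ⊢
      rw [div_mul_eq_mul_div, div_mul_eq_mul_div, ← add_div, h, zero_div]

/-- Singular value decomposition of a `2 × 2` matrix, with complex diagonal. -/
theorem exists_unitary_diagonal_unitary (Φ : Matrix (Fin 2) (Fin 2) ℂ) :
    ∃ (U V : Matrix.unitaryGroup (Fin 2) ℂ) (d : Fin 2 → ℂ),
      Φ = U.1 * Matrix.diagonal d * V.1 := by
  have hH : (Φᴴ * Φ).IsHermitian := Matrix.isHermitian_conjTranspose_mul_self Φ
  set W := hH.eigenvectorUnitary
  have hW : W.1 * W.1ᴴ = 1 := Matrix.mem_unitaryGroup_iff.1 W.2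
  have hW' : W.1ᴴ * W.1 = 1 := Matrix.mem_unitaryGroup_iff'.1 W.2
  set G := Φ * W.1 with hG
  have hdiag : Gᴴ * G = Matrix.diagonal (RCLike.ofReal ∘ hH.eigenvalues) := by
    have := hH.conjStarAlgAut_star_eigenvectorUnitary
    rw [Unitary.conjStarAlgAut_star_apply] at this
    rw [← this, hG, Matrix.conjTranspose_mul]
    simp only [Matrix.mul_assoc]
    rfl
  have horth : star (G 0 0) * G 0 1 + star (G 1 0) * G 1 1 = 0 := by
    have := congrFun (congrFun hdiag 0) 1
    simpa [Matrix.mul_apply, Fin.sum_univ_two] using this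
  obtain ⟨u, v, huv, h1, h2⟩ := exists_unit_vector_parallel_orthogonal horth
  set U : Matrix.unitaryGroup (Fin 2) ℂ := ⟨_, mem_unitaryGroup_of_unit_vector huv⟩ with hU
  have hUU : U.1 * U.1ᴴ = 1 := Matrix.mem_unitaryGroup_iff.1 U.2
  have hD : U.1ᴴ * G = Matrix.diagonal ![(U.1ᴴ * G) 0 0, (U.1ᴴ * G) 1 1] := by
    ext i j
    fin_cases i <;> fin_cases j <;> simp [Matrix.mul_apply, Fin.sum_univ_two, hU]
    · simpa using h2
    · linear_combination h1
  refine ⟨U, star W, ![(U.1ᴴ * G) 0 0, (U.1ᴴ * G) 1 1], ?_⟩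
  rw [← hD, ← Matrix.mul_assoc, hUU, Matrix.one_mul, hG]
  simp only [Unitary.coe_star, Matrix.star_eq_conjTranspose]
  rw [Matrix.mul_assoc, hW, Matrix.mul_one]

/-! ### Fidelity -/

theorem isMaximallyEntangled_iff (ψ : Fin 2 × Fin 2 → ℂ) :
    IsMaximallyEntangled ψ ↔
      (Matrix.of fun i j => ψ (i, j)) * (Matrix.of fun i j => ψ (i, j))ᴴ
        = (1 / 2 : ℂ) • (1 : Matrix (Fin 2) (Fin 2) ℂ) := by
  have : reducedDensity ψ = (Matrix.of fun i j => ψ (i, j)) * (Matrix.of fun i j => ψ (i, j))ᴴ := by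
    ext i k
    simp [reducedDensity, Matrix.mul_apply]
  rw [IsMaximallyEntangled, this]

theorem IsMaximallyEntangled.row {ψ : Fin 2 × Fin 2 → ℂ} (h : IsMaximallyEntangled ψ)
    (i k : Fin 2) : ψ (i, 0) * star (ψ (k, 0)) + ψ (i, 1) * star (ψ (k, 1))
      = if i = k then 1 / 2 else 0 := by
  have := congrFun (congrFun h i) k
  simpa [reducedDensity, Matrix.one_apply, Fin.sum_univ_two] using this

/-- The other reduced state of a maximally entangled state is maximally mixed as well. -/
theorem IsMaximallyEntangled.column {ψ : Fin 2 × Fin 2 → ℂ} (h : IsMaximallyEntangled ψ)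
    (j l : Fin 2) : star (ψ (0, j)) * ψ (0, l) + star (ψ (1, j)) * ψ (1, l)
      = if j = l then 1 / 2 else 0 := by
  rw [isMaximallyEntangled_iff] at h
  set M : Matrix (Fin 2) (Fin 2) ℂ := Matrix.of fun i j => ψ (i, j)
  have h1 : M * ((2 : ℂ) • Mᴴ) = 1 := by
    rw [Matrix.mul_smul, h, smul_smul]; norm_num
  rw [mul_eq_one_comm] at h1
  have := congrFun (congrFun h1 j) l
  simp [Matrix.mul_apply, Fin.sum_univ_two, M, Matrix.one_apply] at this
  split_ifs at this ⊢ <;> simp <;> linear_combination this / 2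

/-- The partial transpose of a maximally entangled projector `|ψ⟩⟨ψ|` is `1 / 2 - |φ⟩⟨φ|` for
another maximally entangled `φ`. Pairing this with the positive operator `ρ^Γ + N / 2` gives the
upper bound on the fidelity. -/
theorem overlap_le {ρ : TwoQubitOp} (hρ : IsState ρ) {ψ : Fin 2 × Fin 2 → ℂ}
    (hψ : IsMaximallyEntangled ψ) : overlap ρ ψ ≤ (1 + negativity ρ) / 2 := by
  have hP := posSemidef_partialTranspose_add hρ.1.1
  have hpos := hP.re_dotProduct_nonneg
    fun p => if p.2 = 0 then -ψ (p.1, 1) else ψ (p.1, 0)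
  rw [quadraticForm_eq_sum] at hpos
  have htr : ρ (0, 0) (0, 0) + ρ (0, 1) (0, 1) + (ρ (1, 0) (1, 0) + ρ (1, 1) (1, 1)) = 1 := by
    simpa [Matrix.trace, Fintype.sum_prod_type, Fin.sum_univ_two] using hρ.2
  have h00 := hψ.row 0 0
  have h01 := hψ.row 0 1
  have h10 := hψ.row 1 0
  have h11 := hψ.row 1 1
  have key : (∑ p : Fin 2 × Fin 2, ∑ q : Fin 2 × Fin 2,
      star (if p.2 = 0 then -ψ (p.1, 1) else ψ (p.1, 0)) *
      (partialTranspose ρ + ((negativity ρ / 2 : ℝ) : ℂ) • (1 : TwoQubitOp)) p q *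
      (if q.2 = 0 then -ψ (q.1, 1) else ψ (q.1, 0)))
      = ((1 + negativity ρ) / 2 : ℝ) - star ψ ⬝ᵥ (ρ *ᵥ ψ) := by
    rw [quadraticForm_eq_sum]
    simp [Fintype.sum_prod_type, Fin.sum_univ_two, partialTranspose, Matrix.one_apply]
      at h00 h01 h10 h11 ⊢
    linear_combination
      (ρ (0, 0) (0, 0) + ρ (0, 1) (0, 1) + negativity ρ / 2) * h00 +
      (ρ (0, 0) (1, 0) + ρ (0, 1) (1, 1)) * h10 +
      (ρ (1, 0) (0, 0) + ρ (1, 1) (0, 1)) * h01 +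
      (ρ (1, 0) (1, 0) + ρ (1, 1) (1, 1) + negativity ρ / 2) * h11 + htr / 2
  rw [key] at hpos
  simp only [RCLike.re_to_complex, Complex.sub_re, Complex.ofReal_re] at hpos
  rw [overlap]
  linarith

theorem overlap_le_fidelity {ρ : TwoQubitOp} (hρ : IsState ρ) {ψ : Fin 2 × Fin 2 → ℂ}
    (hψ : IsMaximallyEntangled ψ) : overlap ρ ψ ≤ fidelity ρ := by
  refine le_csSup ⟨(1 + negativity ρ) / 2, ?_⟩ ⟨ψ, hψ, rfl⟩
  rintro x ⟨φ, hφ, rfl⟩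
  exact overlap_le hρ hφ

/-- The maximally entangled vector `(|01⟩ + w |10⟩) / √2`. -/
theorem isMaximallyEntangled_antiparallel {w : ℂ} (hw : ‖w‖ = 1) : IsMaximallyEntangled
    fun p => if p = (0, 1) then (√(1 / 2) : ℝ) else if p = (1, 0) then w * (√(1 / 2) : ℝ) else 0 := by
  have hs : ((√(1 / 2) : ℝ) : ℂ) * (√(1 / 2) : ℝ) = 1 / 2 := by
    rw [← Complex.ofReal_mul, Real.mul_self_sqrt (by norm_num)]; norm_num
  have hw' : w * star w = 1 := by
    rw [Complex.star_def, Complex.mul_conj, Complex.normSq_eq_norm_sq, hw]; norm_num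
  ext i k
  fin_cases i <;> fin_cases k <;> simp [reducedDensity, Fin.sum_univ_two] <;> simp at hs hw'
  · linear_combination hs
  · linear_combination hs * w * (starRingEnd ℂ) w + hw' / 2

/-- The maximally entangled vector `(|00⟩ + w |11⟩) / √2`. -/
theorem isMaximallyEntangled_parallel {w : ℂ} (hw : ‖w‖ = 1) : IsMaximallyEntangled
    fun p => if p = (0, 0) then (√(1 / 2) : ℝ) else if p = (1, 1) then w * (√(1 / 2) : ℝ) else 0 := by
  have hs : ((√(1 / 2) : ℝ) : ℂ) * (√(1 / 2) : ℝ) = 1 / 2 := by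
    rw [← Complex.ofReal_mul, Real.mul_self_sqrt (by norm_num)]; norm_num
  have hw' : w * star w = 1 := by
    rw [Complex.star_def, Complex.mul_conj, Complex.normSq_eq_norm_sq, hw]; norm_num
  ext i k
  fin_cases i <;> fin_cases k <;> simp [reducedDensity, Fin.sum_univ_two] <;> simp at hs hw'
  · linear_combination hs
  · linear_combination hs * w * (starRingEnd ℂ) w + hw' / 2

theorem fidelity_le {ρ : TwoQubitOp} {x : ℝ}
    (h : ∀ ψ, IsMaximallyEntangled ψ → overlap ρ ψ ≤ x) : fidelity ρ ≤ x := by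
  refine csSup_le ⟨_, _, isMaximallyEntangled_parallel (w := 1) (by simp), rfl⟩ ?_
  rintro x ⟨φ, hφ, rfl⟩
  exact h φ hφ

theorem fidelity_le_of_negativity {ρ : TwoQubitOp} (hρ : IsState ρ) :
    fidelity ρ ≤ (1 + negativity ρ) / 2 := fidelity_le fun _ => overlap_le hρ

/-! ### The entries of a state in a product basis

The whole argument only uses the populations `⟨ij|ρ|ij⟩` and the modulus of the coherence
`⟨01|ρ|10⟩` of a state, in all local bases. -/

/-- The population `⟨ij|ρ|ij⟩`. -/
def population (ρ : TwoQubitOp) (i j : Fin 2) : ℝ := (ρ (i, j) (i, j)).re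

/-- The modulus of the coherence `⟨01|ρ|10⟩`. -/
noncomputable def coherence (ρ : TwoQubitOp) : ℝ := ‖ρ (0, 1) (1, 0)‖

theorem coherence_nonneg (ρ : TwoQubitOp) : 0 ≤ coherence ρ := norm_nonneg _

theorem population_nonneg {ρ : TwoQubitOp} (hρ : ρ.PosSemidef) (i j : Fin 2) :
    0 ≤ population ρ i j := (Complex.le_def.1 hρ.diag_nonneg).1

theorem IsState.sum_population {ρ : TwoQubitOp} (hρ : IsState ρ) :
    population ρ 0 0 + population ρ 0 1 + population ρ 1 0 + population ρ 1 1 = 1 := by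
  have := congrArg Complex.re hρ.2
  simp [Matrix.trace, Fintype.sum_prod_type, Fin.sum_univ_two] at this
  simp only [population]
  linarith

/-- A principal `2 × 2` minor of a positive semidefinite matrix is nonnegative. -/
theorem norm_sq_le_of_posSemidef {A : TwoQubitOp} (hA : A.PosSemidef) (p q : Fin 2 × Fin 2) :
    ‖A p q‖ ^ 2 ≤ (A p p).re * (A q q).re := by
  have h := (hA.submatrix ![p, q]).det_nonneg
  rw [Matrix.det_fin_two] at h
  simp only [Matrix.submatrix_apply, Matrix.cons_val_zero, Matrix.cons_val_one] at h
  have h1 : A q p = star (A p q) := (hA.1.apply q p).symm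
  have hp : A p p = ((A p p).re : ℂ) := (Complex.conj_eq_iff_re.1 (hA.1.apply p p)).symm
  have hq : A q q = ((A q q).re : ℂ) := (Complex.conj_eq_iff_re.1 (hA.1.apply q q)).symm
  rw [h1, Complex.star_def, Complex.mul_conj, Complex.normSq_eq_norm_sq, hp, hq] at h
  have := (Complex.le_def.1 h).1
  simp only [← Complex.ofReal_mul, ← Complex.ofReal_sub, Complex.ofReal_re, Complex.zero_re] at this
  linarith

theorem coherence_sq_le {ρ : TwoQubitOp} (hρ : ρ.PosSemidef) :
    coherence ρ ^ 2 ≤ population ρ 0 1 * population ρ 1 0 := norm_sq_le_of_posSemidef hρ _ _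

theorem two_mul_coherence_le {ρ : TwoQubitOp} (hρ : ρ.PosSemidef) :
    2 * coherence ρ ≤ population ρ 0 1 + population ρ 1 0 := by
  have := coherence_sq_le hρ
  have h1 := population_nonneg hρ 0 1
  have h2 := population_nonneg hρ 1 0
  refine abs_le_of_sq_le_sq' ?_ (by positivity) |>.2
  nlinarith [sq_nonneg (population ρ 0 1 - population ρ 1 0)]

theorem antiparallel_le_fidelity {ρ : TwoQubitOp} (hρ : IsState ρ) :
    (population ρ 0 1 + population ρ 1 0) / 2 + coherence ρ ≤ fidelity ρ := by
  -- the phase of the superposition is chosen to make the contribution of the coherence positive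
  obtain ⟨w, hw, hwz⟩ : ∃ w : ℂ, ‖w‖ = 1 ∧ ρ (0, 1) (1, 0) * w = (coherence ρ : ℂ) := by
    by_cases hz : ρ (0, 1) (1, 0) = 0
    · exact ⟨1, by simp, by simp [coherence, hz]⟩
    · have hn : (‖ρ (0, 1) (1, 0)‖ : ℂ) ≠ 0 := by simpa using hz
      refine ⟨star (ρ (0, 1) (1, 0)) / ‖ρ (0, 1) (1, 0)‖, ?_, ?_⟩
      · simp [hz]
      · rw [mul_div_assoc', div_eq_iff hn, Complex.star_def, Complex.mul_conj,
          Complex.normSq_eq_norm_sq, coherence]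
        push_cast; ring
  refine le_trans (le_of_eq ?_) (overlap_le_fidelity hρ (isMaximallyEntangled_antiparallel hw))
  have hs : ((√(1 / 2) : ℝ) : ℂ) * (√(1 / 2) : ℝ) = 1 / 2 := by
    rw [← Complex.ofReal_mul, Real.mul_self_sqrt (by norm_num)]; norm_num
  have hw' : w * star w = 1 := by
    rw [Complex.star_def, Complex.mul_conj, Complex.normSq_eq_norm_sq, hw]; norm_num
  have hc : ρ (1, 0) (0, 1) * star w = (coherence ρ : ℂ) := by
    have := congrArg star hwz
    rw [← hρ.1.1.apply]
    simpa [mul_comm] using this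
  have key : star (fun p : Fin 2 × Fin 2 => if p = (0, 1) then ((√(1 / 2) : ℝ) : ℂ) else
      if p = (1, 0) then w * (√(1 / 2) : ℝ) else 0) ⬝ᵥ (ρ *ᵥ fun p => if p = (0, 1) then
      ((√(1 / 2) : ℝ) : ℂ) else if p = (1, 0) then w * (√(1 / 2) : ℝ) else 0)
      = (ρ (0, 1) (0, 1) + ρ (1, 0) (1, 0)) / 2 + coherence ρ := by
    rw [quadraticForm_eq_sum]
    simp [Fintype.sum_prod_type, Fin.sum_univ_two] at hs hw' hc ⊢
    linear_combination (ρ (0, 1) (0, 1) + coherence ρ * 2 + ρ (1, 0) (1, 0) * w *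
      (starRingEnd ℂ) w) * hs + (√2 : ℂ)⁻¹ * (√2 : ℂ)⁻¹ * (hwz + hc) + ρ (1, 0) (1, 0) / 2 * hw'
  rw [overlap, key]
  simp [population]

theorem parallel_le_fidelity {ρ : TwoQubitOp} (hρ : IsState ρ) :
    (population ρ 0 0 + population ρ 1 1) / 2 ≤ fidelity ρ := by
  have hs : ((√(1 / 2) : ℝ) : ℂ) * (√(1 / 2) : ℝ) = 1 / 2 := by
    rw [← Complex.ofReal_mul, Real.mul_self_sqrt (by norm_num)]; norm_num
  -- the average of the overlaps with `(|00⟩ ± |11⟩) / √2`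
  have h1 := overlap_le_fidelity hρ (isMaximallyEntangled_parallel (w := 1) (by simp))
  have h2 := overlap_le_fidelity hρ (isMaximallyEntangled_parallel (w := -1) (by simp))
  have key (w : ℂ) : star (fun p : Fin 2 × Fin 2 => if p = (0, 0) then ((√(1 / 2) : ℝ) : ℂ) else
      if p = (1, 1) then w * (√(1 / 2) : ℝ) else 0) ⬝ᵥ (ρ *ᵥ fun p => if p = (0, 0) then
      ((√(1 / 2) : ℝ) : ℂ) else if p = (1, 1) then w * (√(1 / 2) : ℝ) else 0)
      = (ρ (0, 0) (0, 0) + ρ (0, 0) (1, 1) * w + star w * ρ (1, 1) (0, 0)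
        + star w * ρ (1, 1) (1, 1) * w) / 2 := by
    rw [quadraticForm_eq_sum]
    simp [Fintype.sum_prod_type, Fin.sum_univ_two] at hs ⊢
    linear_combination (ρ (0, 0) (0, 0) + ρ (0, 0) (1, 1) * w + (starRingEnd ℂ) w *
      ρ (1, 1) (0, 0) + (starRingEnd ℂ) w * ρ (1, 1) (1, 1) * w) * hs
  rw [overlap, key] at h1 h2
  simp at h1 h2
  simp only [population]
  linarith

theorem IsMaximallyEntangled.kronecker_mulVec {ψ : Fin 2 × Fin 2 → ℂ}
    (hψ : IsMaximallyEntangled ψ) (U V : Matrix.unitaryGroup (Fin 2) ℂ) :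
    IsMaximallyEntangled ((U.1 ⊗ₖ V.1) *ᵥ ψ) := by
  rw [isMaximallyEntangled_iff] at hψ ⊢
  set M : Matrix (Fin 2) (Fin 2) ℂ := Matrix.of fun i j => ψ (i, j) with hM
  have h : (Matrix.of fun i j => ((U.1 ⊗ₖ V.1) *ᵥ ψ) (i, j)) = U.1 * M * V.1ᵀ := by
    ext i j
    simp [Matrix.mulVec, dotProduct, Fintype.sum_prod_type, Fin.sum_univ_two, Matrix.mul_apply, hM]
    ring
  have hU : U.1 * U.1ᴴ = 1 := Matrix.mem_unitaryGroup_iff.1 U.2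
  have hV : V.1ᵀ * (V.1ᵀ)ᴴ = 1 := by
    have : V.1ᴴ * V.1 = 1 := Matrix.mem_unitaryGroup_iff'.1 V.2
    have h2 := congrArg Matrix.transpose this
    rw [Matrix.transpose_mul, Matrix.transpose_one] at h2
    exact h2
  rw [h, Matrix.conjTranspose_mul, Matrix.conjTranspose_mul,
    show U.1 * M * V.1ᵀ * ((V.1ᵀ)ᴴ * (Mᴴ * U.1ᴴ)) = U.1 * (M * (V.1ᵀ * (V.1ᵀ)ᴴ) * Mᴴ) * U.1ᴴ by
      simp only [Matrix.mul_assoc], hV, Matrix.mul_one, hψ]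
  simp [hU]

theorem overlap_localConj (U V : Matrix.unitaryGroup (Fin 2) ℂ) (ρ : TwoQubitOp)
    (ψ : Fin 2 × Fin 2 → ℂ) :
    overlap (localConj U V ρ) ψ = overlap ρ (((star U).1 ⊗ₖ (star V).1) *ᵥ ψ) := by
  have : (star U).1 ⊗ₖ (star V).1 = (U.1 ⊗ₖ V.1)ᴴ := (Matrix.conjTranspose_kronecker _ _).symm
  rw [overlap, overlap, localConj, this, Matrix.star_mulVec, Matrix.conjTranspose_conjTranspose,
    Matrix.mul_assoc, ← Matrix.mulVec_mulVec, ← Matrix.mulVec_mulVec, Matrix.dotProduct_mulVec]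

theorem fidelity_localConj (U V : Matrix.unitaryGroup (Fin 2) ℂ) (ρ : TwoQubitOp) :
    fidelity (localConj U V ρ) = fidelity ρ := by
  have h (U V : Matrix.unitaryGroup (Fin 2) ℂ) (ρ : TwoQubitOp) :
      {x : ℝ | ∃ ψ, IsMaximallyEntangled ψ ∧ x = overlap (localConj U V ρ) ψ} ⊆
      {x : ℝ | ∃ ψ, IsMaximallyEntangled ψ ∧ x = overlap ρ ψ} := by
    rintro x ⟨ψ, hψ, rfl⟩
    exact ⟨_, hψ.kronecker_mulVec (star U) (star V), overlap_localConj U V ρ ψ⟩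
  have h2 := h (star U) (star V) (localConj U V ρ)
  rw [localConj_mul, Unitary.star_mul_self, Unitary.star_mul_self, localConj_one] at h2
  exact congrArg sSup (Set.Subset.antisymm (h U V ρ) h2)

/-! ### Negativity in terms of populations and coherence -/

theorem coherence_sq_le_negativity {ρ : TwoQubitOp} (hρ : ρ.IsHermitian)
    (U V : Matrix.unitaryGroup (Fin 2) ℂ) :
    (2 * coherence (localConj U V ρ)) ^ 2 ≤
      (negativity ρ + 2 * population (localConj U V ρ) 0 0) *
        (negativity ρ + 2 * population (localConj U V ρ) 1 1) := by
  have h := (posSemidef_partialTranspose_add hρ).mul_mul_conjTranspose_same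
    (U.1 ⊗ₖ (conjUnitary V).1)
  have h1 : (U.1 ⊗ₖ (conjUnitary V).1) *
      (partialTranspose ρ + ((negativity ρ / 2 : ℝ) : ℂ) • (1 : TwoQubitOp)) *
      (U.1 ⊗ₖ (conjUnitary V).1)ᴴ = partialTranspose (localConj U V ρ) +
        ((negativity ρ / 2 : ℝ) : ℂ) • (1 : TwoQubitOp) := by
    rw [partialTranspose_localConj, localConj, Matrix.mul_add, Matrix.add_mul, Matrix.mul_smul,
      Matrix.smul_mul, Matrix.mul_one,
      mul_eq_one_comm.1 (kronecker_conjTranspose_mul_self U (conjUnitary V))]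
  rw [h1] at h
  have h2 := norm_sq_le_of_posSemidef h (0, 0) (1, 1)
  simp [partialTranspose] at h2
  simp only [coherence, population]
  linarith

theorem sum_norm_sq_eq (φ : Fin 2 × Fin 2 → ℂ) :
    ((∑ p, ‖φ p‖ ^ 2 : ℝ) : ℂ) = star φ ⬝ᵥ φ := by
  simp [dotProduct, ← Complex.normSq_eq_conj_mul_self, Complex.normSq_eq_norm_sq]

theorem norm_det_unitaryGroup (U : Matrix.unitaryGroup (Fin 2) ℂ) : ‖U.1.det‖ = 1 := by
  have h : U.1ᴴ * U.1 = 1 := Matrix.mem_unitaryGroup_iff'.1 U.2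
  have h2 := congrArg Matrix.det h
  rw [Matrix.det_mul, Matrix.det_conjTranspose, Matrix.det_one, Complex.star_def,
    ← Complex.normSq_eq_conj_mul_self, Complex.normSq_eq_norm_sq] at h2
  have h3 : ‖U.1.det‖ ^ 2 = 1 := by exact_mod_cast h2
  exact (pow_eq_one_iff_of_nonneg (norm_nonneg _) two_ne_zero).1 h3

/-- In the Schmidt basis of a vector `φ` the quadratic form of `ρ^Γ` at `φ` only involves two
populations and one coherence. -/
theorem exists_localConj_le_quadraticForm {ρ : TwoQubitOp} (hρ : ρ.IsHermitian)
    (φ : Fin 2 × Fin 2 → ℂ) :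
    ∃ (U V : Matrix.unitaryGroup (Fin 2) ℂ) (a b : ℝ), 0 ≤ a ∧ 0 ≤ b ∧
      a ^ 2 + b ^ 2 = ∑ p, ‖φ p‖ ^ 2 ∧ a * b = ‖φ (0, 0) * φ (1, 1) - φ (0, 1) * φ (1, 0)‖ ∧
      a ^ 2 * population (localConj U V ρ) 0 0 + b ^ 2 * population (localConj U V ρ) 1 1
        - 2 * a * b * coherence (localConj U V ρ)
        ≤ (star φ ⬝ᵥ (partialTranspose ρ *ᵥ φ)).re := by
  obtain ⟨U, V, d, hd⟩ := exists_unitary_diagonal_unitary (Matrix.of fun i j => φ (i, j))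
  set W : TwoQubitOp := U.1 ⊗ₖ V.1ᵀ with hW
  set δ : Fin 2 × Fin 2 → ℂ := fun p => if p.1 = p.2 then d p.1 else 0 with hδ
  have hφ : φ = W *ᵥ δ := by
    ext ⟨i, j⟩
    have := congrFun (congrFun hd i) j
    simp [Matrix.mul_apply, Fin.sum_univ_two, Matrix.diagonal_apply] at this
    rw [this]
    simp [Matrix.mulVec, dotProduct, Fintype.sum_prod_type, Fin.sum_univ_two, hW, hδ]
    ring
  have hWconj : Wᴴ = (star U).1 ⊗ₖ (conjUnitary V).1 := by
    rw [hW, Matrix.conjTranspose_kronecker]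
    rfl
  have hWW : Wᴴ * W = 1 := by
    have h1 := kronecker_conjTranspose_mul_self (star U) (conjUnitary V)
    rw [← hWconj, Matrix.conjTranspose_conjTranspose] at h1
    exact mul_eq_one_comm.1 h1
  have hform : star φ ⬝ᵥ (partialTranspose ρ *ᵥ φ) =
      star δ ⬝ᵥ (partialTranspose (localConj (star U) V ρ) *ᵥ δ) := by
    rw [partialTranspose_localConj, localConj, ← hWconj, Matrix.conjTranspose_conjTranspose, hφ,
      Matrix.star_mulVec, Matrix.mul_assoc, ← Matrix.mulVec_mulVec, ← Matrix.mulVec_mulVec,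
      Matrix.dotProduct_mulVec]
    simp [Matrix.vecMul_vecMul, Matrix.dotProduct_mulVec, Matrix.mul_assoc]
  refine ⟨star U, V, ‖d 0‖, ‖d 1‖, norm_nonneg _, norm_nonneg _, ?_, ?_, ?_⟩
  · have h1 : star φ ⬝ᵥ φ = star δ ⬝ᵥ δ := by
      rw [hφ, Matrix.star_mulVec, Matrix.dotProduct_mulVec, Matrix.vecMul_vecMul, hWW,
        Matrix.vecMul_one]
    rw [← sum_norm_sq_eq, ← sum_norm_sq_eq] at h1
    rw [Complex.ofReal_injective h1]
    simp [Fintype.sum_prod_type, Fin.sum_univ_two, hδ]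
  · have := congrArg (fun M => ‖Matrix.det M‖) hd
    simp only [Matrix.det_mul, norm_mul, norm_det_unitaryGroup, Matrix.det_diagonal,
      Fin.prod_univ_two, one_mul, mul_one] at this
    rw [← this, Matrix.det_fin_two]
    rfl
  · have hσ : (localConj (star U) V ρ).IsHermitian :=
      Matrix.isHermitian_mul_mul_conjTranspose _ hρ
    rw [hform, quadraticForm_eq_sum]
    set σ := localConj (star U) V ρ
    have h10 : σ (1, 0) (0, 1) = star (σ (0, 1) (1, 0)) := (hσ.apply _ _).symm
    have h00 : σ (0, 0) (0, 0) = (population σ 0 0 : ℂ) :=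
      (Complex.conj_eq_iff_re.1 (hσ.apply _ _)).symm
    have h11 : σ (1, 1) (1, 1) = (population σ 1 1 : ℂ) :=
      (Complex.conj_eq_iff_re.1 (hσ.apply _ _)).symm
    have e0 : (starRingEnd ℂ) (d 0) * d 0 = ((‖d 0‖ ^ 2 : ℝ) : ℂ) := by
      rw [← Complex.normSq_eq_conj_mul_self, Complex.normSq_eq_norm_sq]
    have e1 : (starRingEnd ℂ) (d 1) * d 1 = ((‖d 1‖ ^ 2 : ℝ) : ℂ) := by
      rw [← Complex.normSq_eq_conj_mul_self, Complex.normSq_eq_norm_sq]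
    have key : (∑ p : Fin 2 × Fin 2, ∑ q : Fin 2 × Fin 2,
        star (δ p) * partialTranspose σ p q * δ q) =
        ((‖d 0‖ ^ 2 * population σ 0 0 + ‖d 1‖ ^ 2 * population σ 1 1 : ℝ) : ℂ) +
          (star (d 0) * σ (0, 1) (1, 0) * d 1 + star (star (d 0) * σ (0, 1) (1, 0) * d 1)) := by
      simp [Fintype.sum_prod_type, Fin.sum_univ_two, hδ, partialTranspose, h10, h00, h11] at e0 e1 ⊢
      linear_combination population σ 0 0 * e0 + population σ 1 1 * e1
    rw [key]
    have hb := Complex.abs_re_le_norm (star (d 0) * σ (0, 1) (1, 0) * d 1)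
    rw [norm_mul, norm_mul, norm_star] at hb
    have := (abs_le.1 hb).1
    have hre : (star (star (d 0) * σ (0, 1) (1, 0) * d 1)).re =
        (star (d 0) * σ (0, 1) (1, 0) * d 1).re := Complex.conj_re _
    rw [Complex.add_re, Complex.ofReal_re, Complex.add_re, hre]
    rw [coherence]
    linarith

/-- If the negativity is positive, the bound `coherence_sq_le_negativity` is attained in some
product basis, namely the Schmidt basis of an eigenvector of `ρ^Γ`. -/
theorem exists_localConj_negativity_le {ρ : TwoQubitOp} (hρ : IsState ρ) (hN : 0 < negativity ρ) :
    ∃ U V : Matrix.unitaryGroup (Fin 2) ℂ,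
      (negativity ρ + 2 * population (localConj U V ρ) 0 0) *
        (negativity ρ + 2 * population (localConj U V ρ) 1 1) ≤
      (2 * coherence (localConj U V ρ)) ^ 2 := by
  have hm : negativity ρ = -2 * minEigenvalue (partialTranspose ρ) := by
    unfold negativity at hN ⊢
    exact max_eq_right (by by_contra h; rw [max_eq_left (not_le.1 h).le] at hN; exact hN.false)
  obtain ⟨φ, h1, h2⟩ := exists_eigenvector_minEigenvalue (isHermitian_partialTranspose hρ.1.1)
  obtain ⟨U, V, a, b, ha, hb, hab, -, h⟩ := exists_localConj_le_quadraticForm hρ.1.1 φ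
  refine ⟨U, V, ?_⟩
  have hp0 := population_nonneg (hρ.localConj U V).1 0 0
  have hp1 := population_nonneg (hρ.localConj U V).1 1 1
  have hc := coherence_nonneg (localConj U V ρ)
  set p := population (localConj U V ρ) 0 0
  set q := population (localConj U V ρ) 1 1
  set y := coherence (localConj U V ρ)
  set N := negativity ρ
  rw [h2, show minEigenvalue (partialTranspose ρ) = -(N / 2) by linarith] at h
  have h3 : a ^ 2 * (N + 2 * p) + b ^ 2 * (N + 2 * q) ≤ 2 * (a * b) * (2 * y) := by
    have : a ^ 2 + b ^ 2 = 1 := hab.trans h1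
    nlinarith
  have hA : 0 < N + 2 * p := by linarith
  have hB : 0 < N + 2 * q := by linarith
  have hab0 : 0 < a * b := by
    by_contra hcon
    have h0 : a * b = 0 := le_antisymm (not_lt.1 hcon) (mul_nonneg ha hb)
    rw [h0] at h3
    have h4 : 0 ≤ b ^ 2 * (N + 2 * q) := by positivity
    have h5 : 0 ≤ a ^ 2 * (N + 2 * p) := by positivity
    have h6 : a ^ 2 = 0 := by nlinarith
    have h7 : b ^ 2 = 0 := by nlinarith
    have : a ^ 2 + b ^ 2 = 1 := hab.trans h1
    linarith
  have h5 : (2 * (a * b)) ^ 2 * ((N + 2 * p) * (N + 2 * q)) ≤ (2 * (a * b)) ^ 2 * (2 * y) ^ 2 := by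
    have e1 : 4 * ((a ^ 2 * (N + 2 * p)) * (b ^ 2 * (N + 2 * q))) ≤
        (a ^ 2 * (N + 2 * p) + b ^ 2 * (N + 2 * q)) ^ 2 := by
      nlinarith [sq_nonneg (a ^ 2 * (N + 2 * p) - b ^ 2 * (N + 2 * q))]
    have e2 := pow_le_pow_left₀ (by positivity) h3 2
    calc _ = 4 * ((a ^ 2 * (N + 2 * p)) * (b ^ 2 * (N + 2 * q))) := by ring
      _ ≤ _ := e1.trans e2
      _ = _ := by ring
  exact le_of_mul_le_mul_left h5 (by positivity)

/-! ### Takagi factorisation -/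

section Takagi

variable {ι : Type*} [Fintype ι]

/-- A symmetric complex matrix `τ` maps some unit vector in the orthogonal complement of the rows
of `A` to a nonnegative multiple of its conjugate, if the conjugates of these rows have the same
property. The antilinear map `J x = conj (τ x)` preserves the complement, its square is complex
linear and has an eigenvalue `μ ^ 2`; then `J` itself has the eigenvalue `μ`. -/
theorem exists_takagi_vector {τ : Matrix ι ι ℂ} (hτ : τᵀ = τ) {k : ℕ} (hk : k < Fintype.card ι)
    (A : Matrix (Fin k) ι ℂ) (l : Fin k → ℝ)
    (hA : τ * Aᴴ = Aᵀ * Matrix.diagonal fun i => (l i : ℂ)) :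
    ∃ (x : ι → ℂ) (μ : ℝ), 0 ≤ μ ∧ A *ᵥ x = 0 ∧ star x ⬝ᵥ x = 1 ∧ τ *ᵥ x = (μ : ℂ) • star x := by
  have hτ' : τᴴᵀ = τᴴ := by
    conv_rhs => rw [← hτ]
    rfl
  set S : Submodule ℂ (ι → ℂ) := LinearMap.ker A.mulVecLin with hS
  have memS (x : ι → ℂ) : x ∈ S ↔ A *ᵥ x = 0 := by rw [hS, LinearMap.mem_ker]; rfl
  have hne : S ≠ ⊥ := by
    refine LinearMap.ker_ne_bot_of_finrank_lt ?_
    simpa using hk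
  have hnt : Nontrivial S := Submodule.nontrivial_iff_ne_bot.2 hne
  have hJ (x : ι → ℂ) (hx : x ∈ S) : star (τ *ᵥ x) ∈ S := by
    rw [memS] at hx ⊢
    have h1 : (τ * Aᴴ)ᵀ *ᵥ x = 0 := by
      rw [hA, Matrix.transpose_mul, Matrix.transpose_transpose, ← Matrix.mulVec_mulVec, hx,
        Matrix.mulVec_zero]
    rw [Matrix.transpose_mul, hτ] at h1
    have h2 := congrArg star h1
    rw [Matrix.star_mulVec, Matrix.conjTranspose_mul, star_zero] at h2
    rw [Matrix.star_mulVec, ← Matrix.vecMul_transpose, Matrix.vecMul_vecMul]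
    rwa [show Aᴴᵀᴴ = Aᵀ by ext; simp] at h2
  have hJJ (x : ι → ℂ) : star (τ *ᵥ star (τ *ᵥ x)) = (τᴴ * τ) *ᵥ x := by
    rw [Matrix.star_mulVec, star_star, ← Matrix.mulVec_transpose, ← Matrix.mulVec_mulVec, hτ']
  have hmap (x : ι → ℂ) (hx : x ∈ S) : (τᴴ * τ).mulVecLin x ∈ S := by
    have := hJ _ (hJ x hx)
    rwa [hJJ] at this
  obtain ⟨c, hc⟩ := Module.End.exists_eigenvalue ((τᴴ * τ).mulVecLin.restrict hmap)
  obtain ⟨⟨x, hxS⟩, hx, hx0⟩ := hc.exists_hasEigenvector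
  have hx0' : x ≠ 0 := fun h => hx0 (Subtype.ext h)
  have hxc : (τᴴ * τ) *ᵥ x = c • x := congrArg Subtype.val (Module.End.mem_eigenspace_iff.1 hx)
  -- the eigenvalue is nonnegative
  have hpos : 0 < star x ⬝ᵥ x := Matrix.dotProduct_star_self_pos_iff.2 hx0'
  have hc0 : 0 ≤ c := by
    have h1 : star x ⬝ᵥ ((τᴴ * τ) *ᵥ x) = c * (star x ⬝ᵥ x) := by rw [hxc, dotProduct_smul]; rfl
    have h2 := (Matrix.posSemidef_conjTranspose_mul_self τ).dotProduct_mulVec_nonneg x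
    rw [h1] at h2
    exact le_of_mul_le_mul_right (by simpa using h2) hpos
  have hcr : c = ((√c.re * √c.re : ℝ) : ℂ) := by
    rw [Real.mul_self_sqrt (Complex.le_def.1 hc0).1]
    exact Complex.ext (by simp) (by simpa using (Complex.le_def.1 hc0).2.symm)
  set μ := √c.re with hμ
  have hJx : star (τ *ᵥ star (τ *ᵥ x)) = ((μ * μ : ℝ) : ℂ) • x := by rw [hJJ, hxc, hcr]
  have hmain : ∃ y ∈ S, y ≠ 0 ∧ τ *ᵥ y = (μ : ℂ) • star y := by
    by_cases hw : (μ : ℂ) • x + star (τ *ᵥ x) = 0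
    · refine ⟨Complex.I • x, S.smul_mem _ hxS, smul_ne_zero Complex.I_ne_zero hx0', ?_⟩
      have h1 := congrArg star (eq_neg_of_add_eq_zero_right hw)
      rw [star_star] at h1
      rw [Matrix.mulVec_smul, h1]
      ext i
      simp
      ring
    · refine ⟨_, S.add_mem (S.smul_mem (μ : ℂ) hxS) (hJ x hxS), hw, ?_⟩
      have h1 := congrArg star hJx
      rw [star_star] at h1
      rw [Matrix.mulVec_add, Matrix.mulVec_smul, h1]
      ext i
      simp
      ring
  obtain ⟨y, hyS, hy0, hy⟩ := hmain
  have hypos : 0 < star y ⬝ᵥ y := Matrix.dotProduct_star_self_pos_iff.2 hy0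
  have hyr : star y ⬝ᵥ y = ((star y ⬝ᵥ y).re : ℂ) :=
    Complex.ext (by simp) (by simpa using (Complex.lt_def.1 hypos).2.symm)
  have hr : 0 < (star y ⬝ᵥ y).re := (Complex.lt_def.1 hypos).1
  refine ⟨((√(star y ⬝ᵥ y).re : ℝ) : ℂ)⁻¹ • y, μ, Real.sqrt_nonneg _, ?_, ?_, ?_⟩
  · rw [← memS]; exact S.smul_mem _ hyS
  · rw [star_smul, smul_dotProduct, dotProduct_smul, hyr, Complex.star_def, ← Complex.ofReal_inv,
      Complex.conj_ofReal, smul_eq_mul, smul_eq_mul, Complex.ofReal_re, ← Complex.ofReal_mul,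
      ← Complex.ofReal_mul]
    have hs := Real.mul_self_sqrt hr.le
    have hs0 := (Real.sqrt_pos.2 hr).ne'
    rw [← hs]
    simp only [Real.sqrt_mul_self (Real.sqrt_nonneg _)]
    field_simp
    simp
  · rw [Matrix.mulVec_smul, hy, star_smul, ← Complex.ofReal_inv, Complex.star_def,
      Complex.conj_ofReal, smul_comm]

theorem exists_partial_takagi [DecidableEq ι] {τ : Matrix ι ι ℂ} (hτ : τᵀ = τ) (k : ℕ)
    (hk : k ≤ Fintype.card ι) :
    ∃ (A : Matrix (Fin k) ι ℂ) (l : Fin k → ℝ), A * Aᴴ = 1 ∧ (∀ i, 0 ≤ l i) ∧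
      τ * Aᴴ = Aᵀ * Matrix.diagonal fun i => (l i : ℂ) := by
  induction k with
  | zero =>
    refine ⟨0, 0, ?_, fun i => i.elim0, ?_⟩
    · ext i; exact i.elim0
    · ext i j; exact j.elim0
  | succ k ih =>
    obtain ⟨A, l, hA1, hl, hA2⟩ := ih (by omega)
    obtain ⟨x, μ, hμ, hx1, hx2, hx3⟩ := exists_takagi_vector hτ (by omega) A l hA2
    obtain ⟨A', hlast, hcast⟩ : ∃ A' : Matrix (Fin (k + 1)) ι ℂ,
        (∀ a, A' (Fin.last k) a = star (x a)) ∧ ∀ i a, A' (Fin.castSucc i) a = A i a :=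
      ⟨Matrix.of (Fin.snoc (α := fun _ => ι → ℂ) A (star x)),
        fun a => congrFun (Fin.snoc_last (α := fun _ => ι → ℂ) (star x) A) a,
        fun i a => congrFun (Fin.snoc_castSucc (α := fun _ => ι → ℂ) (star x) A i) a⟩
    obtain ⟨l', hlast', hcast'⟩ : ∃ l' : Fin (k + 1) → ℝ,
        l' (Fin.last k) = μ ∧ ∀ i, l' (Fin.castSucc i) = l i :=
      ⟨Fin.snoc (α := fun _ => ℝ) l μ, by simp, by simp⟩
    refine ⟨A', l', ?_, ?_, ?_⟩
    · have hAx (i : Fin k) : ∑ a, A i a * x a = 0 := congrFun hx1 i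
      ext i j
      rw [Matrix.mul_apply]
      simp only [Matrix.conjTranspose_apply]
      refine Fin.lastCases ?_ (fun i => ?_) i <;> refine Fin.lastCases ?_ (fun j => ?_) j
      · simpa [hlast, dotProduct] using hx2
      · have h := congrArg star (hAx j)
        rw [star_sum] at h
        simp only [star_mul', star_zero] at h
        rw [Matrix.one_apply_ne (Fin.castSucc_lt_last j).ne', ← h]
        simp only [hlast, hcast, mul_comm]
      · rw [Matrix.one_apply_ne (Fin.castSucc_lt_last i).ne, ← hAx i]
        simp only [hlast, hcast, star_star]
      · have h := congrFun (congrFun hA1 i) j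
        simp only [Matrix.mul_apply, Matrix.conjTranspose_apply] at h
        simp only [hcast, h, Matrix.one_apply, Fin.castSucc_inj]
    · intro i
      refine Fin.lastCases ?_ (fun i => ?_) i
      · simpa [hlast'] using hμ
      · simpa [hcast'] using hl i
    · ext a j
      rw [Matrix.mul_diagonal, Matrix.mul_apply]
      simp only [Matrix.conjTranspose_apply, Matrix.transpose_apply]
      refine Fin.lastCases ?_ (fun j => ?_) j
      · have h := congrFun hx3 a
        simp only [Matrix.mulVec, dotProduct] at h
        simp [hlast, hlast', h, mul_comm]
      · have h := congrFun (congrFun hA2 a) j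
        rw [Matrix.mul_diagonal, Matrix.mul_apply] at h
        simpa [hcast, hcast'] using h

/-- **Takagi factorisation** of a symmetric complex matrix, with the largest singular value at a
prescribed position. -/
theorem exists_takagi [DecidableEq ι] {τ : Matrix ι ι ℂ} (hτ : τᵀ = τ) (i₀ : ι) :
    ∃ (V : Matrix ι ι ℂ) (l : ι → ℝ), V * Vᴴ = 1 ∧ (∀ i, 0 ≤ l i) ∧ (∀ i, l i ≤ l i₀) ∧
      Vᵀ * τ * V = Matrix.diagonal fun i => (l i : ℂ) := by
  obtain ⟨A, l, hA1, hl, hA2⟩ := exists_partial_takagi hτ (Fintype.card ι) le_rfl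
  have : Nonempty ι := ⟨i₀⟩
  set e := Fintype.equivFin ι
  obtain ⟨m, hm⟩ := Finite.exists_max (l ∘ e)
  set f : ι ≃ Fin (Fintype.card ι) := (Equiv.swap i₀ m).trans e with hf
  refine ⟨(A.submatrix f id)ᴴ, l ∘ f, ?_, fun i => hl _, fun i => ?_, ?_⟩
  · rw [mul_eq_one_comm, Matrix.conjTranspose_conjTranspose, Matrix.conjTranspose_submatrix,
      ← Matrix.submatrix_mul _ _ _ _ _ Function.bijective_id, hA1, Matrix.submatrix_one_equiv]
  · simpa [hf] using hm (Equiv.swap i₀ m i)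
  · have h1 : Aᴴᵀ * (τ * Aᴴ) = Matrix.diagonal fun i => (l i : ℂ) := by
      rw [hA2, ← Matrix.mul_assoc, ← Matrix.transpose_mul, hA1, Matrix.transpose_one,
        Matrix.one_mul]
    have h2 := congrArg (fun M => Matrix.submatrix M f f) h1
    simp only [Matrix.submatrix_diagonal_equiv] at h2
    rw [Matrix.submatrix_mul _ _ _ _ _ Function.bijective_id,
      Matrix.submatrix_mul _ _ _ _ _ Function.bijective_id, ← Matrix.mul_assoc] at h2
    exact h2

end Takagi

/-! ### Concurrence through Takagi decompositions -/

/-- The complex bilinear form `σ_y ⊗ σ_y` of the spin flip. -/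
def spinForm : TwoQubitOp := pauliY ⊗ₖ pauliY

theorem spinForm_apply (p q : Fin 2 × Fin 2) : spinForm p q =
    if p.1 = q.1 ∨ p.2 = q.2 then 0 else if p.1 = p.2 then -1 else 1 := by
  obtain ⟨i, j⟩ := p
  obtain ⟨k, l⟩ := q
  fin_cases i <;> fin_cases j <;> fin_cases k <;> fin_cases l <;> simp [spinForm, pauliY]

theorem spinForm_transpose : spinFormᵀ = spinForm := by
  ext p q
  rw [Matrix.transpose_apply, spinForm_apply, spinForm_apply]
  obtain ⟨i, j⟩ := p
  obtain ⟨k, l⟩ := q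
  fin_cases i <;> fin_cases j <;> fin_cases k <;> fin_cases l <;> simp

theorem spinForm_map_star : spinForm.map star = spinForm := by
  ext p q
  rw [Matrix.map_apply, spinForm_apply]
  split_ifs <;> simp

/-- A Takagi decomposition of `ρ`: a decomposition `ρ = X Xᴴ = ∑ₖ |xₖ⟩⟨xₖ|` into subnormalised
pure states for which the matrix of spin-flip overlaps `⟨xₖ*|σ_y ⊗ σ_y|xₘ⟩` is diagonal with
entries `l k ≥ 0`, the largest entry being listed first. -/
def IsTakagi (ρ X : TwoQubitOp) (l : Fin 2 × Fin 2 → ℝ) : Prop :=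
  X * Xᴴ = ρ ∧ Xᵀ * spinForm * X = Matrix.diagonal (fun k => (l k : ℂ)) ∧
    (∀ k, 0 ≤ l k) ∧ ∀ k, l k ≤ l (0, 0)

theorem exists_eq_mul_conjTranspose {ρ : TwoQubitOp} (hρ : ρ.PosSemidef) :
    ∃ X : TwoQubitOp, X * Xᴴ = ρ := by
  open scoped MatrixOrder in
  obtain ⟨B, hB⟩ := CStarAlgebra.nonneg_iff_eq_star_mul_self.1 hρ.nonneg
  exact ⟨Bᴴ, by rw [Matrix.conjTranspose_conjTranspose, hB]; rfl⟩

theorem exists_isTakagi {ρ : TwoQubitOp} (hρ : ρ.PosSemidef) : ∃ X l, IsTakagi ρ X l := by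
  obtain ⟨X, hX⟩ := exists_eq_mul_conjTranspose hρ
  have hτ : (Xᵀ * spinForm * X)ᵀ = Xᵀ * spinForm * X := by
    rw [Matrix.transpose_mul, Matrix.transpose_mul, Matrix.transpose_transpose, spinForm_transpose,
      Matrix.mul_assoc]
  obtain ⟨V, l, hV, hl, hmax, h⟩ := exists_takagi hτ (0, 0)
  refine ⟨X * V, l, ?_, ?_, hl, hmax⟩
  · rw [Matrix.conjTranspose_mul, Matrix.mul_assoc, ← Matrix.mul_assoc V, hV, Matrix.one_mul, hX]
  · rw [← h, Matrix.transpose_mul]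
    simp only [Matrix.mul_assoc]

theorem IsTakagi.woottersValues {ρ X : TwoQubitOp} {l : Fin 2 × Fin 2 → ℝ} (h : IsTakagi ρ X l) :
    woottersValues ρ = Finset.univ.val.map l := by
  obtain ⟨hX, hd, hl, -⟩ := h
  have h1 : ρ * spinFlip ρ = X * (Xᴴ * spinForm * X.map star * (Xᵀ * spinForm)) := by
    have : ρ.map star = X.map star * Xᵀ := by
      rw [← hX]
      ext i j
      simp [Matrix.mul_apply]
    rw [spinFlip, this, ← hX]
    simp only [spinForm, Matrix.mul_assoc]
  have h2 : Xᴴ * spinForm * X.map star = Matrix.diagonal (fun k => (l k : ℂ)) := by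
    have := congrArg (fun M : TwoQubitOp => M.map (starRingEnd ℂ)) hd
    simp only [Matrix.map_mul] at this
    have e1 : Xᵀ.map (starRingEnd ℂ) = Xᴴ := rfl
    have e2 : spinForm.map (starRingEnd ℂ) = spinForm := spinForm_map_star
    rw [e1, e2] at this
    refine this.trans ?_
    rw [Matrix.diagonal_map (map_zero _)]
    simp
  have h3 : (ρ * spinFlip ρ).charpoly =
      ((Finset.univ.val.map fun k => ((l k : ℂ) * l k)).map
        fun a => Polynomial.X - Polynomial.C a).prod := by
    rw [h1, Matrix.charpoly_mul_comm, Matrix.mul_assoc, hd, h2, Matrix.diagonal_mul_diagonal,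
      Matrix.charpoly_diagonal, Multiset.map_map]
    rfl
  rw [_root_.woottersValues, h3, Polynomial.roots_multiset_prod_X_sub_C, Multiset.map_map]
  refine Multiset.map_congr rfl fun k _ => ?_
  rw [Function.comp_apply, ← Complex.ofReal_mul, Complex.ofReal_re, Real.sqrt_mul_self (hl k)]

/-- **Wootters' formula** in terms of a Takagi decomposition. -/
theorem IsTakagi.concurrence {ρ X : TwoQubitOp} {l : Fin 2 × Fin 2 → ℝ} (h : IsTakagi ρ X l) :
    concurrence ρ = max 0 (l (0, 0) - l (0, 1) - l (1, 0) - l (1, 1)) := by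
  have huniv : (Finset.univ : Finset (Fin 2 × Fin 2)).val = {(0, 0), (0, 1), (1, 0), (1, 1)} := by
    decide
  rw [_root_.concurrence, h.woottersValues, huniv]
  obtain ⟨-, -, hl, hmax⟩ := h
  have e : max (l (0, 0)) (max (l (0, 1)) (max (l (1, 0)) (max (l (1, 1)) 0))) = l (0, 0) := by
    simp [hl, hmax]
  simp only [Multiset.insert_eq_cons, Multiset.map_cons, Multiset.map_singleton,
    Multiset.fold_cons_left, Multiset.fold_singleton, Multiset.sum_cons, Multiset.sum_singleton, e]
  congr 1
  ring

theorem transpose_mul_pauliY_mul (U : Matrix (Fin 2) (Fin 2) ℂ) :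
    Uᵀ * pauliY * U = U.det • pauliY := by
  ext i j
  fin_cases i <;> fin_cases j <;>
    simp [pauliY, Matrix.mul_apply, Fin.sum_univ_two, Matrix.det_fin_two] <;> ring

theorem exists_phase_sq_eq {z : ℂ} (hz : ‖z‖ = 1) : ∃ w : ℂ, ‖w‖ = 1 ∧ w ^ 2 = z := by
  obtain ⟨w, hw⟩ := IsAlgClosed.exists_pow_nat_eq z (n := 2) (by norm_num)
  refine ⟨w, ?_, hw⟩
  have := congrArg norm hw
  rw [norm_pow, hz] at this
  exact (pow_eq_one_iff_of_nonneg (norm_nonneg _) two_ne_zero).1 this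

theorem smul_mul_conjTranspose_of_norm_one {w : ℂ} (hw : ‖w‖ = 1) (X : TwoQubitOp) :
    (w • X) * (w • X)ᴴ = X * Xᴴ := by
  have hw' : w * star w = 1 := by
    rw [Complex.star_def, Complex.mul_conj, Complex.normSq_eq_norm_sq, hw]; norm_num
  rw [Matrix.conjTranspose_smul, Matrix.smul_mul, Matrix.mul_smul, smul_smul, hw', one_smul]

theorem IsTakagi.localConj {ρ X : TwoQubitOp} {l : Fin 2 × Fin 2 → ℝ} (h : IsTakagi ρ X l)
    (U V : Matrix.unitaryGroup (Fin 2) ℂ) : ∃ X', IsTakagi (localConj U V ρ) X' l := by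
  obtain ⟨hX, hd, hl⟩ := h
  have hdet : ‖U.1.det * V.1.det‖ = 1 := by
    rw [norm_mul, norm_det_unitaryGroup, norm_det_unitaryGroup, one_mul]
  obtain ⟨w, hw, hwz⟩ := exists_phase_sq_eq (z := (U.1.det * V.1.det)⁻¹)
    (by rw [norm_inv, hdet, inv_one])
  replace hwz : w ^ 2 * (U.1.det * V.1.det) = 1 := by
    rw [hwz, inv_mul_cancel₀ (norm_ne_zero_iff.1 (by rw [hdet]; exact one_ne_zero))]
  have hform : (U.1 ⊗ₖ V.1)ᵀ * spinForm * (U.1 ⊗ₖ V.1) = (U.1.det * V.1.det) • spinForm := by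
    rw [spinForm, ← Matrix.kroneckerMap_transpose, ← Matrix.mul_kronecker_mul,
      ← Matrix.mul_kronecker_mul, transpose_mul_pauliY_mul, transpose_mul_pauliY_mul,
      Matrix.smul_kronecker, Matrix.kronecker_smul, smul_smul]
  refine ⟨w • ((U.1 ⊗ₖ V.1) * X), ?_, ?_, hl⟩
  · rw [smul_mul_conjTranspose_of_norm_one hw, Matrix.conjTranspose_mul, _root_.localConj, ← hX]
    simp only [Matrix.mul_assoc]
  · rw [Matrix.transpose_smul, Matrix.transpose_mul]
    have : (w • (Xᵀ * (U.1 ⊗ₖ V.1)ᵀ)) * spinForm * (w • ((U.1 ⊗ₖ V.1) * X)) =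
        (w * w) • (Xᵀ * ((U.1 ⊗ₖ V.1)ᵀ * spinForm * (U.1 ⊗ₖ V.1)) * X) := by
      simp only [Matrix.mul_assoc, Matrix.smul_mul, Matrix.mul_smul, smul_smul]
    rw [this, hform, Matrix.mul_smul, Matrix.smul_mul, smul_smul, hd, ← pow_two, hwz, one_smul]

theorem concurrence_localConj {ρ : TwoQubitOp} (hρ : ρ.PosSemidef)
    (U V : Matrix.unitaryGroup (Fin 2) ℂ) : concurrence (localConj U V ρ) = concurrence ρ := by
  obtain ⟨X, l, h⟩ := exists_isTakagi hρ
  obtain ⟨X', h'⟩ := h.localConj U V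
  rw [h.concurrence, h'.concurrence]

theorem concurrence_nonneg (ρ : TwoQubitOp) : 0 ≤ concurrence ρ := le_max_left _ _

/-! ### Upper bound on the coherence -/

/-- A closed polygon: two vectors of lengths `a, b` can be given directions such that their sum is
any complex number whose modulus lies between `|a - b|` and `a + b`. -/
theorem exists_phases_add_eq {a b r : ℝ} (ha : 0 ≤ a) (hb : 0 ≤ b) (h1 : |a - b| ≤ r)
    (h2 : r ≤ a + b) : ∃ u v : ℂ, ‖u‖ = 1 ∧ ‖v‖ = 1 ∧ u * a + v * b = r := by
  have hr : 0 ≤ r := (abs_nonneg _).trans h1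
  -- intermediate value theorem for the angle between the two vectors
  obtain ⟨θ, -, hθ⟩ : r ∈ (fun θ : ℝ => ‖(a : ℂ) + Complex.exp (θ * Complex.I) * b‖) ''
      Set.Icc 0 Real.pi := by
    have hc : Continuous fun θ : ℝ => ‖(a : ℂ) + Complex.exp (θ * Complex.I) * b‖ := by fun_prop
    refine intermediate_value_Icc' Real.pi_pos.le hc.continuousOn ⟨?_, ?_⟩
    · simp only [Complex.exp_pi_mul_I]
      rw [show (a : ℂ) + -1 * b = ((a - b : ℝ) : ℂ) by push_cast; ring, Complex.norm_real]
      exact h1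
    · simp only [Complex.ofReal_zero, zero_mul, Complex.exp_zero, one_mul]
      rw [← Complex.ofReal_add, Complex.norm_real, Real.norm_eq_abs, abs_of_nonneg (by positivity)]
      exact h2
  simp only at hθ
  have he : ‖Complex.exp (θ * Complex.I)‖ = 1 := Complex.norm_exp_ofReal_mul_I θ
  set z := (a : ℂ) + Complex.exp (θ * Complex.I) * b
  obtain ⟨w, hw, hwz⟩ : ∃ w : ℂ, ‖w‖ = 1 ∧ w * z = ‖z‖ := by
    by_cases hz : z = 0
    · exact ⟨1, by simp, by simp [hz]⟩
    · have hn : (‖z‖ : ℂ) ≠ 0 := by simpa using hz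
      refine ⟨star z / ‖z‖, by simp [hz], ?_⟩
      rw [div_mul_eq_mul_div, div_eq_iff hn, Complex.star_def, ← Complex.normSq_eq_conj_mul_self,
        Complex.normSq_eq_norm_sq]
      push_cast; ring
  refine ⟨w, w * Complex.exp (θ * Complex.I), hw, by rw [norm_mul, hw, he, one_mul], ?_⟩
  rw [← hθ, ← hwz]
  ring

theorem exists_phases_norm_sum_le {a b c d : ℝ} (hb : 0 ≤ b) (hc : 0 ≤ c) (hd : 0 ≤ d)
    (hab : b ≤ a) (hac : c ≤ a) (had : d ≤ a) :
    ∃ s t u v : ℂ, ‖s‖ = 1 ∧ ‖t‖ = 1 ∧ ‖u‖ = 1 ∧ ‖v‖ = 1 ∧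
      ‖s * a + t * b + u * c + v * d‖ ≤ max 0 (a - b - c - d) := by
  have ha : 0 ≤ a := hb.trans hab
  rcases le_total (a - b - c - d) 0 with h | h
  · -- a common length of the partial sums `s a + t b` and `u c + v d`
    have hm1 : |a - b| ≤ max (a - b) |c - d| := by
      rw [abs_of_nonneg (sub_nonneg.2 hab)]; exact le_max_left _ _
    have hcd : |c - d| ≤ c + d := abs_le.2 ⟨by linarith, by linarith⟩
    have hcd' : |c - d| ≤ a := abs_le.2 ⟨by linarith, by linarith⟩
    obtain ⟨s, t, hs, ht, h1⟩ := exists_phases_add_eq ha hb hm1 (max_le (by linarith) (by linarith))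
    obtain ⟨u, v, hu, hv, h2⟩ := exists_phases_add_eq hc hd (le_max_right (a - b) |c - d|)
      (max_le (by linarith) hcd)
    refine ⟨s, t, -u, -v, hs, ht, by simpa using hu, by simpa using hv, ?_⟩
    rw [show s * a + t * b + -u * c + -v * d = (s * a + t * b) - (u * c + v * d) by ring, h1, h2,
      sub_self, norm_zero]
    exact le_max_left _ _
  · refine ⟨1, -1, -1, -1, by simp, by simp, by simp, by simp, ?_⟩
    rw [show (1 : ℂ) * a + -1 * b + -1 * c + -1 * d = ((a - b - c - d : ℝ) : ℂ) by push_cast; ring,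
      Complex.norm_real, Real.norm_eq_abs, abs_of_nonneg h]
    exact le_max_right _ _

theorem transpose_mul_spinForm_mul_apply (X : TwoQubitOp) (k m : Fin 2 × Fin 2) :
    (Xᵀ * spinForm * X) k m = X (0, 1) k * X (1, 0) m + X (1, 0) k * X (0, 1) m
      - X (0, 0) k * X (1, 1) m - X (1, 1) k * X (0, 0) m := by
  simp only [Matrix.mul_apply, Fintype.sum_prod_type, Fin.sum_univ_two, Matrix.transpose_apply,
    spinForm_apply]
  simp
  ring

theorem population_eq_sum {ρ X : TwoQubitOp} (h : X * Xᴴ = ρ) (i j : Fin 2) :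
    population ρ i j = ∑ k, ‖X (i, j) k‖ ^ 2 := by
  have : ρ (i, j) (i, j) = ((∑ k, ‖X (i, j) k‖ ^ 2 : ℝ) : ℂ) := by
    rw [← h, Matrix.mul_apply, Complex.ofReal_sum]
    refine Finset.sum_congr rfl fun k _ => ?_
    rw [Matrix.conjTranspose_apply, Complex.star_def, Complex.mul_conj, Complex.normSq_eq_norm_sq]
  rw [population, this, Complex.ofReal_re]

/-- In any decomposition of `ρ` into pure states, the coherence is bounded by the average
concurrence of the pure states. -/
theorem two_mul_coherence_le_sum {ρ X : TwoQubitOp} (h : X * Xᴴ = ρ) :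
    2 * coherence ρ ≤ 2 * √(population ρ 0 0 * population ρ 1 1) +
      ∑ k, ‖(Xᵀ * spinForm * X) k k‖ := by
  have hp (i j : Fin 2) : 0 ≤ population ρ i j := by
    rw [population_eq_sum h]; exact Finset.sum_nonneg fun _ _ => sq_nonneg _
  have h1 : coherence ρ ≤ ∑ k, ‖X (0, 1) k * X (1, 0) k‖ := by
    rw [coherence, ← h, Matrix.mul_apply]
    refine (norm_sum_le _ _).trans (Finset.sum_le_sum fun k _ => ?_)
    rw [norm_mul, norm_mul, Matrix.conjTranspose_apply, norm_star]
  have h2 : ∑ k, ‖X (0, 0) k * X (1, 1) k‖ ≤ √(population ρ 0 0 * population ρ 1 1) := by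
    rw [Real.sqrt_mul (hp 0 0), population_eq_sum h, population_eq_sum h]
    simp only [norm_mul]
    exact Real.sum_mul_le_sqrt_mul_sqrt _ _ _
  have h3 (k : Fin 2 × Fin 2) : 2 * ‖X (0, 1) k * X (1, 0) k‖ ≤
      2 * ‖X (0, 0) k * X (1, 1) k‖ + ‖(Xᵀ * spinForm * X) k k‖ := by
    have e : 2 * (X (0, 1) k * X (1, 0) k) =
        2 * (X (0, 0) k * X (1, 1) k) + (Xᵀ * spinForm * X) k k := by
      rw [transpose_mul_spinForm_mul_apply]; ring
    have := norm_add_le (2 * (X (0, 0) k * X (1, 1) k)) ((Xᵀ * spinForm * X) k k)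
    rw [← e, norm_mul 2, norm_mul 2] at this
    simpa using this
  have h4 := Finset.sum_le_sum fun k (_ : k ∈ Finset.univ) => h3 k
  rw [Finset.sum_add_distrib, ← Finset.mul_sum, ← Finset.mul_sum] at h4
  linarith

/-- The `4 × 4` Hadamard matrix, normalised to be orthogonal. -/
noncomputable def hadamardTwo : TwoQubitOp :=
  Matrix.of fun p q => (if p.1 = 1 ∧ q.1 = 1 then -1 else 1) *
    (if p.2 = 1 ∧ q.2 = 1 then -1 else 1) / 2

theorem hadamardTwo_mul_conjTranspose : hadamardTwo * hadamardTwoᴴ = 1 := by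
  ext ⟨i, j⟩ ⟨k, l⟩
  fin_cases i <;> fin_cases j <;> fin_cases k <;> fin_cases l <;>
    simp [hadamardTwo, Matrix.mul_apply, Fintype.sum_prod_type, Fin.sum_univ_two] <;> norm_num

/-- The concurrence bounds the coherence. Multiplying the vectors of a Takagi decomposition by
phases for which `∑ₖ wₖ² l k` has modulus `C` and mixing them with a Hadamard matrix gives a
decomposition all of whose pure states have the same concurrence, in total `C`. -/
theorem two_mul_coherence_le_concurrence {ρ : TwoQubitOp} (hρ : ρ.PosSemidef) :
    2 * coherence ρ ≤ 2 * √(population ρ 0 0 * population ρ 1 1) + concurrence ρ := by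
  obtain ⟨X, l, hT⟩ := exists_isTakagi hρ
  rw [hT.concurrence]
  obtain ⟨hX, hd, hl, hmax⟩ := hT
  obtain ⟨s, t, u, v, hs, ht, hu, hv, hsum⟩ := exists_phases_norm_sum_le (hl (0, 1)) (hl (1, 0))
    (hl (1, 1)) (hmax (0, 1)) (hmax (1, 0)) (hmax (1, 1))
  obtain ⟨s', hs', rfl⟩ := exists_phase_sq_eq hs
  obtain ⟨t', ht', rfl⟩ := exists_phase_sq_eq ht
  obtain ⟨u', hu', rfl⟩ := exists_phase_sq_eq hu
  obtain ⟨v', hv', rfl⟩ := exists_phase_sq_eq hv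
  set w : Fin 2 × Fin 2 → ℂ := fun p => !![s', t'; u', v'] p.1 p.2 with hw
  have hw1 (p : Fin 2 × Fin 2) : ‖w p‖ = 1 := by
    obtain ⟨i, j⟩ := p
    fin_cases i <;> fin_cases j <;> simpa [hw]
  set G : TwoQubitOp := Matrix.diagonal w * hadamardTwo with hG
  have hGG : G * Gᴴ = 1 := by
    rw [hG, Matrix.conjTranspose_mul, Matrix.mul_assoc, ← Matrix.mul_assoc hadamardTwo,
      hadamardTwo_mul_conjTranspose, Matrix.one_mul, Matrix.diagonal_conjTranspose,
      Matrix.diagonal_mul_diagonal, ← Matrix.diagonal_one]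
    congr 1
    ext p
    rw [Pi.star_apply, Complex.star_def, Complex.mul_conj, Complex.normSq_eq_norm_sq, hw1]
    simp
  have hXG : (X * G) * (X * G)ᴴ = ρ := by
    rw [Matrix.conjTranspose_mul, Matrix.mul_assoc, ← Matrix.mul_assoc G, hGG, Matrix.one_mul, hX]
  have hdiag (k : Fin 2 × Fin 2) : ((X * G)ᵀ * spinForm * (X * G)) k k =
      (s' ^ 2 * l (0, 0) + t' ^ 2 * l (0, 1) + u' ^ 2 * l (1, 0) + v' ^ 2 * l (1, 1)) / 4 := by
    have e : (X * G)ᵀ * spinForm * (X * G) = Gᵀ * (Xᵀ * spinForm * X) * G := by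
      rw [Matrix.transpose_mul]; simp only [Matrix.mul_assoc]
    rw [e, hd, Matrix.mul_apply]
    simp only [Matrix.mul_diagonal, hG, Matrix.diagonal_mul, Matrix.transpose_apply]
    obtain ⟨i, j⟩ := k
    fin_cases i <;> fin_cases j <;>
      simp [Fintype.sum_prod_type, Fin.sum_univ_two, hadamardTwo, hw] <;> ring
  have hfin := two_mul_coherence_le_sum hXG
  simp only [hdiag, Finset.sum_const, Finset.card_univ, Fintype.card_prod, Fintype.card_fin,
    norm_div, nsmul_eq_mul] at hfin
  norm_num at hfin
  linarith

theorem two_mul_coherence_localConj_le_concurrence {ρ : TwoQubitOp} (hρ : IsState ρ)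
    (U V : Matrix.unitaryGroup (Fin 2) ℂ) :
    2 * coherence (localConj U V ρ) ≤
      2 * √(population (localConj U V ρ) 0 0 * population (localConj U V ρ) 1 1) +
        concurrence ρ := by
  rw [← concurrence_localConj hρ.1 U V]
  exact two_mul_coherence_le_concurrence (hρ.localConj U V).1

/-! ### Quaternionic triples of `2 × 2` matrices -/

theorem mul_add_mul_eq_zero_of_trace {A B : Matrix (Fin 2) (Fin 2) ℂ} (hA : A.trace = 0)
    (hB : B.trace = 0) (h : (A * B).trace = 0) : A * B + B * A = 0 := by
  rw [Matrix.trace_fin_two] at hA hB h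
  simp only [Matrix.mul_apply, Fin.sum_univ_two] at h
  have hA' : A 1 1 = -A 0 0 := by linear_combination hA
  have hB' : B 1 1 = -B 0 0 := by linear_combination hB
  rw [hA', hB'] at h
  ext i j
  fin_cases i <;> fin_cases j <;>
    simp [Matrix.mul_apply, Fin.sum_univ_two, hA', hB'] <;> first | linear_combination h | ring

theorem mul_self_eq_neg_one_of_trace {A : Matrix (Fin 2) (Fin 2) ℂ} (hA : A.trace = 0)
    (hd : A.det = 1) : A * A = -1 := by
  rw [Matrix.trace_fin_two] at hA
  rw [Matrix.det_fin_two] at hd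
  have hA' : A 1 1 = -A 0 0 := by linear_combination hA
  rw [hA'] at hd
  ext i j
  fin_cases i <;> fin_cases j <;>
    simp [Matrix.mul_apply, Fin.sum_univ_two, hA'] <;> first | linear_combination -hd | ring

theorem eq_smul_one_of_mul_self {G : Matrix (Fin 2) (Fin 2) ℂ} (hG : G * G = 1)
    (hd : G.det = 1) : ∃ g : ℂ, g ^ 2 = 1 ∧ G = g • (1 : Matrix (Fin 2) (Fin 2) ℂ) := by
  have h1 : G.trace • G = (2 : ℂ) • (1 : Matrix (Fin 2) (Fin 2) ℂ) := by
    have hCH : G * G = G.trace • G - G.det • (1 : Matrix (Fin 2) (Fin 2) ℂ) := by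
      ext i j
      rw [Matrix.trace_fin_two, Matrix.det_fin_two]
      fin_cases i <;> fin_cases j <;> simp [Matrix.mul_apply, Fin.sum_univ_two] <;> ring
    rw [hd, hG, one_smul] at hCH
    rw [two_smul]
    exact (eq_sub_iff_add_eq.1 hCH).symm
  have ht : G.trace ≠ 0 := by
    intro h
    rw [h, zero_smul] at h1
    have := congrFun (congrFun h1 0) 0
    simp at this
  have hG' : G = (G.trace⁻¹ * 2) • (1 : Matrix (Fin 2) (Fin 2) ℂ) := by
    rw [mul_smul, ← h1, smul_smul, inv_mul_cancel₀ ht, one_smul]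
  refine ⟨_, ?_, hG'⟩
  rw [hG'] at hd
  simpa [pow_two] using hd

/-- Three traceless matrices of determinant one that are orthogonal for the trace form multiply
like the quaternion units `i, j, k`, up to sign. -/
theorem quaternion_mul_mul_conjTranspose {A B C : Matrix (Fin 2) (Fin 2) ℂ} (hA : A.trace = 0)
    (hB : B.trace = 0) (hC : C.trace = 0) (hA1 : A.det = 1) (hB1 : B.det = 1) (hC1 : C.det = 1)
    (hAB : (A * B).trace = 0) (hAC : (A * C).trace = 0) (hBC : (B * C).trace = 0) :
    (A * B) * (A * B)ᴴ = C * Cᴴ := by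
  have eA := mul_self_eq_neg_one_of_trace hA hA1
  have eB := mul_self_eq_neg_one_of_trace hB hB1
  have eC := mul_self_eq_neg_one_of_trace hC hC1
  have eAC := eq_neg_of_add_eq_zero_left (mul_add_mul_eq_zero_of_trace hA hC hAC)
  have eBC := eq_neg_of_add_eq_zero_left (mul_add_mul_eq_zero_of_trace hB hC hBC)
  have hcomm : (A * B) * C = C * (A * B) := by
    rw [Matrix.mul_assoc, eBC, Matrix.mul_neg, ← Matrix.mul_assoc, eAC, Matrix.neg_mul, neg_neg,
      Matrix.mul_assoc]
  have hABAB : (A * B) * (A * B) = -1 := by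
    calc (A * B) * (A * B) = A * (B * A) * B := by noncomm_ring
      _ = -((A * A) * (B * B)) := by
        rw [eq_neg_of_add_eq_zero_right (mul_add_mul_eq_zero_of_trace hA hB hAB)]; noncomm_ring
      _ = -1 := by rw [eA, eB]; simp
  have hG : (C * (A * B)) * (C * (A * B)) = 1 := by
    calc (C * (A * B)) * (C * (A * B)) = C * ((A * B) * C) * (A * B) := by noncomm_ring
      _ = (C * C) * ((A * B) * (A * B)) := by rw [hcomm]; noncomm_ring
      _ = 1 := by rw [eC, hABAB]; simp
  obtain ⟨g, hg, hGg⟩ := eq_smul_one_of_mul_self hG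
    (by rw [Matrix.det_mul, Matrix.det_mul, hA1, hB1, hC1]; norm_num)
  have hABC : A * B = -(g • C) := by
    have := congrArg (fun M => C * M) hGg
    simp only [← Matrix.mul_assoc, eC, Matrix.mul_smul, Matrix.mul_one] at this
    rw [← this]
    simp
  have hg' : g * star g = 1 := by
    rcases eq_or_eq_neg_of_sq_eq_sq g 1 (by rw [hg, one_pow]) with rfl | rfl <;> simp
  rw [hABC, Matrix.conjTranspose_neg, Matrix.conjTranspose_smul, Matrix.neg_mul, Matrix.mul_neg,
    neg_neg, Matrix.smul_mul, Matrix.mul_smul, smul_smul, hg', one_smul]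

/-- A quaternionic triple becomes unitary after a change of basis: the sum over the quaternion
group defines an inner product that the triple preserves. -/
theorem mul_sum_mul_conjTranspose {A B C : Matrix (Fin 2) (Fin 2) ℂ} (hA : A.trace = 0)
    (hB : B.trace = 0) (hC : C.trace = 0) (hA1 : A.det = 1) (hB1 : B.det = 1) (hC1 : C.det = 1)
    (hAB : (A * B).trace = 0) (hAC : (A * C).trace = 0) (hBC : (B * C).trace = 0) :
    A * (1 + A * Aᴴ + B * Bᴴ + C * Cᴴ) * Aᴴ = 1 + A * Aᴴ + B * Bᴴ + C * Cᴴ := by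
  have h1 := quaternion_mul_mul_conjTranspose hA hB hC hA1 hB1 hC1 hAB hAC hBC
  have h2 := quaternion_mul_mul_conjTranspose hA hC hB hA1 hC1 hB1 hAC hAB
    (by rwa [Matrix.trace_mul_comm])
  have eA := mul_self_eq_neg_one_of_trace hA hA1
  have h0 : (A * A) * (A * A)ᴴ = 1 := by rw [eA]; simp
  rw [Matrix.conjTranspose_mul] at h0 h1 h2
  calc _ = A * Aᴴ + (A * A) * (Aᴴ * Aᴴ) + (A * B) * (Bᴴ * Aᴴ) + (A * C) * (Cᴴ * Aᴴ) := by
        noncomm_ring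
    _ = _ := by rw [h0, h1, h2]; abel

/-- The symplectic form on `ℂ²`. -/
def symplecticTwo : Matrix (Fin 2) (Fin 2) ℂ := !![0, 1; -1, 0]

theorem symplecticTwo_map_star : symplecticTwo.map star = symplecticTwo := by
  ext i j; fin_cases i <;> fin_cases j <;> simp [symplecticTwo]

theorem det_symplecticTwo : symplecticTwo.det = 1 := by
  simp [symplecticTwo, Matrix.det_fin_two]

theorem trace_mul_symplecticTwo (S : Matrix (Fin 2) (Fin 2) ℂ) :
    (S * symplecticTwo * (Sᵀ * symplecticTwo)).trace = -2 * S.det := by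
  rw [Matrix.det_fin_two, Matrix.trace_fin_two]
  simp [symplecticTwo, Matrix.mul_apply, Fin.sum_univ_two]
  ring

theorem map_star_mul_symplecticTwo {Q : Matrix (Fin 2) (Fin 2) ℂ} (hQ : Q.PosDef)
    (K : Matrix (Fin 2) (Fin 2) ℂ) :
    (Kᴴ * Q⁻¹ * symplecticTwo).map star = (Q⁻¹ * K)ᵀ * symplecticTwo := by
  have h : Q⁻¹.map star = Q⁻¹ᵀ := by
    have : Q⁻¹ᴴ = Q⁻¹ := hQ.inv.1
    conv_rhs => rw [← this]
    rfl
  have map_mul (S T : Matrix (Fin 2) (Fin 2) ℂ) : (S * T).map star = S.map star * T.map star :=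
    Matrix.map_mul (f := starRingEnd ℂ)
  rw [map_mul, map_mul, symplecticTwo_map_star, h, Matrix.transpose_mul]
  congr 2
  ext i j
  simp

theorem trace_symplecticTwo_of_preserved {Q K : Matrix (Fin 2) (Fin 2) ℂ} (hQ : Q.PosDef)
    (hK : K * Q * Kᴴ = Q) (hKK : K * K = -1) (hdet : K.det = 1) :
    ((Kᴴ * Q⁻¹ * symplecticTwo) * (Kᴴ * Q⁻¹ * symplecticTwo).map star).trace = 2 * Q.det⁻¹ := by
  have hQu : IsUnit Q.det := (Matrix.isUnit_iff_isUnit_det _).1 hQ.isUnit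
  have h1 : Kᴴ * Q⁻¹ = -(Q⁻¹ * K) := by
    have h2 : K * Q = -(Q * Kᴴ) := by
      have := congrArg (fun M => K * M) hK
      simp only [← Matrix.mul_assoc, hKK] at this
      rw [← this]; simp
    calc Kᴴ * Q⁻¹ = (Q⁻¹ * Q) * Kᴴ * Q⁻¹ := by rw [Matrix.nonsing_inv_mul _ hQu, Matrix.one_mul]
      _ = -(Q⁻¹ * (K * Q) * Q⁻¹) := by rw [h2]; noncomm_ring
      _ = -(Q⁻¹ * K * (Q * Q⁻¹)) := by noncomm_ring
      _ = _ := by rw [Matrix.mul_nonsing_inv _ hQu, Matrix.mul_one]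
  rw [map_star_mul_symplecticTwo hQ, h1, Matrix.neg_mul, Matrix.neg_mul, Matrix.trace_neg,
    trace_mul_symplecticTwo, Matrix.det_mul, hdet, Matrix.det_nonsing_inv, Ring.inverse_eq_inv']
  ring

theorem trace_symplecticTwo_one {Q : Matrix (Fin 2) (Fin 2) ℂ} (hQ : Q.PosDef) :
    (((1 : Matrix (Fin 2) (Fin 2) ℂ)ᴴ * Q⁻¹ * symplecticTwo) *
      ((1 : Matrix (Fin 2) (Fin 2) ℂ)ᴴ * Q⁻¹ * symplecticTwo).map star).trace = -2 * Q.det⁻¹ := by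
  rw [map_star_mul_symplecticTwo hQ, Matrix.conjTranspose_one, Matrix.one_mul, Matrix.mul_one,
    trace_mul_symplecticTwo, Matrix.det_nonsing_inv, Ring.inverse_eq_inv']

/-- The quadratic form of `ρ^Γ` in terms of the vectors of a decomposition, all written as
`2 × 2` matrices. -/
theorem quadraticForm_partialTranspose {ρ X : TwoQubitOp} (h : X * Xᴴ = ρ)
    (Φ : Matrix (Fin 2) (Fin 2) ℂ) :
    star (fun p : Fin 2 × Fin 2 => Φ p.1 p.2) ⬝ᵥ
      (partialTranspose ρ *ᵥ fun p : Fin 2 × Fin 2 => Φ p.1 p.2) =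
    ∑ k, (((Matrix.of fun i j => X (i, j) k)ᴴ * Φ) *
      ((Matrix.of fun i j => X (i, j) k)ᴴ * Φ).map star).trace := by
  rw [quadraticForm_eq_sum]
  simp only [partialTranspose, ← h, Matrix.mul_apply, Matrix.of_apply, Matrix.trace_fin_two,
    Matrix.map_apply, Matrix.conjTranspose_apply, Fintype.sum_prod_type, Fin.sum_univ_two,
    star_add, star_mul', star_star]
  ring

/-- The vectors of a Takagi decomposition without zero entries, written as `2 × 2` matrices and
multiplied from the left by a suitable fixed matrix, are proportional to the identity and a
quaternionic triple. -/
theorem IsTakagi.exists_quaternionic {ρ X : TwoQubitOp} {l : Fin 2 × Fin 2 → ℝ}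
    (h : IsTakagi ρ X l) (hpos : ∀ k, 0 < l k) :
    ∃ (G : Matrix (Fin 2) (Fin 2) ℂ) (K : Fin 2 × Fin 2 → Matrix (Fin 2) (Fin 2) ℂ),
      G.det = -1 ∧ K (0, 0) = 1 ∧ (∀ k, (K k).det = 1) ∧ (∀ k, (0, 0) ≠ k → (K k).trace = 0) ∧
      (∀ j k, (0, 0) ≠ j → j ≠ k → (K j * K k).trace = 0) ∧
      ∀ k, (Matrix.of fun i j => X (i, j) k) = ((√(l k / 2) : ℝ) : ℂ) • (G * K k) := by
  obtain ⟨hX, hd, -, -⟩ := h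
  -- the vectors of the decomposition as `2 × 2` matrices `M k`, and normalised to determinant `-1`
  set M : Fin 2 × Fin 2 → Matrix (Fin 2) (Fin 2) ℂ := fun k => Matrix.of fun i j => X (i, j) k
    with hM
  set d : Fin 2 × Fin 2 → ℝ := fun k => √(l k / 2) with hdef
  have hd0 (k) : 0 < d k := Real.sqrt_pos.2 (by linarith [hpos k])
  have hd0' (k) : (d k : ℂ) ≠ 0 := by exact_mod_cast (hd0 k).ne'
  have hdd (k) : (d k : ℂ) * d k = l k / 2 := by
    rw [← Complex.ofReal_mul, Real.mul_self_sqrt (by linarith [hpos k])]; push_cast; ring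
  set n : Fin 2 × Fin 2 → Matrix (Fin 2) (Fin 2) ℂ := fun k => (d k : ℂ)⁻¹ • M k with hn
  have hMn (k) : M k = (d k : ℂ) • n k := by
    rw [hn]; simp only [smul_smul]; rw [mul_inv_cancel₀ (hd0' k), one_smul]
  have hdet (k) : (n k).det = -1 := by
    have h1 := congrFun (congrFun hd k) k
    rw [transpose_mul_spinForm_mul_apply, Matrix.diagonal_apply_eq] at h1
    have h2 : (M k).det = -(d k : ℂ) * d k := by
      rw [Matrix.det_fin_two, neg_mul, hdd]
      simp only [hM, Matrix.of_apply]
      linear_combination -h1 / 2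
    rw [hn, Matrix.det_smul, h2, Fintype.card_fin]
    field_simp [hd0' k]
  have horth (j k) (hjk : j ≠ k) : ((n j).adjugate * n k).trace = 0 := by
    have h1 := congrFun (congrFun hd j) k
    rw [transpose_mul_spinForm_mul_apply, Matrix.diagonal_apply_ne _ hjk] at h1
    have h2 : ((M j).adjugate * M k).trace = 0 := by
      rw [Matrix.adjugate_fin_two, Matrix.trace_fin_two]
      simp [Matrix.mul_apply, Fin.sum_univ_two, hM]
      linear_combination -h1
    rw [hn]
    simp only [Matrix.adjugate_smul, Matrix.smul_mul, Matrix.mul_smul, Matrix.trace_smul, h2,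
      smul_zero]
  -- relative to the first matrix, the other three form a quaternionic triple
  set K : Fin 2 × Fin 2 → Matrix (Fin 2) (Fin 2) ℂ := fun k => -((n (0, 0)).adjugate * n k)
    with hK
  have hnK (k) : n k = n (0, 0) * K k := by
    rw [hK]
    simp only [Matrix.mul_neg]
    rw [← Matrix.mul_assoc, Matrix.mul_adjugate, hdet]
    simp
  have hK0 : K (0, 0) = 1 := by
    rw [hK]
    simp only [Matrix.adjugate_mul, hdet]
    simp
  have hKdet (k) : (K k).det = 1 := by
    have := congrArg Matrix.det (hnK k)
    rw [Matrix.det_mul, hdet, hdet] at this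
    linear_combination this
  have hKtr (k) (hk : (0, 0) ≠ k) : (K k).trace = 0 := by
    rw [hK, Matrix.trace_neg, horth _ _ hk, neg_zero]
  have hKK (j k) (hj : (0, 0) ≠ j) (hjk : j ≠ k) : (K j * K k).trace = 0 := by
    have h1 : ((K j).adjugate * K k).trace = 0 := by
      have := horth j k hjk
      rw [hnK j, hnK k, Matrix.adjugate_mul_distrib, Matrix.mul_assoc,
        ← Matrix.mul_assoc _ (n (0, 0)), Matrix.adjugate_mul, hdet] at this
      simpa using this
    have h2 : (K j).adjugate = -K j := by
      have := hKtr j hj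
      rw [Matrix.trace_fin_two] at this
      rw [Matrix.adjugate_fin_two]
      ext a b
      fin_cases a <;> fin_cases b <;> simp <;> linear_combination this
    rw [h2, Matrix.neg_mul, Matrix.trace_neg, neg_eq_zero] at h1
    exact h1
  exact ⟨n (0, 0), K, hdet _, hK0, hKdet, hKtr, hKK, fun k => by rw [← hnK]; exact hMn k⟩

/-- A Takagi decomposition without zero entries determines, up to its length, a vector `φ` at
which the quadratic form of `ρ^Γ` gives the concurrence. -/
theorem IsTakagi.exists_quadraticForm_eq {ρ X : TwoQubitOp} {l : Fin 2 × Fin 2 → ℝ}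
    (h : IsTakagi ρ X l) (hpos : ∀ k, 0 < l k) :
    ∃ φ : Fin 2 × Fin 2 → ℂ, φ (0, 0) * φ (1, 1) - φ (0, 1) * φ (1, 0) ≠ 0 ∧
      (star φ ⬝ᵥ (partialTranspose ρ *ᵥ φ)).re =
        -(‖φ (0, 0) * φ (1, 1) - φ (0, 1) * φ (1, 0)‖ *
          (l (0, 0) - l (0, 1) - l (1, 0) - l (1, 1))) := by
  obtain ⟨G, K, hG, hK0, hKdet, hKtr, hKK, hM⟩ := h.exists_quaternionic hpos
  set A := K (0, 1)
  set B := K (1, 0)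
  set C := K (1, 1)
  set Q := 1 + A * Aᴴ + B * Bᴴ + C * Cᴴ with hQ
  have hQpos : Q.PosDef :=
    ((Matrix.PosDef.one.add_posSemidef (Matrix.posSemidef_self_mul_conjTranspose A)).add_posSemidef
      (Matrix.posSemidef_self_mul_conjTranspose B)).add_posSemidef
      (Matrix.posSemidef_self_mul_conjTranspose C)
  have trA : A.trace = 0 := hKtr _ (by decide)
  have trB : B.trace = 0 := hKtr _ (by decide)
  have trC : C.trace = 0 := hKtr _ (by decide)
  have trAB : (A * B).trace = 0 := hKK _ _ (by decide) (by decide)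
  have trAC : (A * C).trace = 0 := hKK _ _ (by decide) (by decide)
  have trBA : (B * A).trace = 0 := hKK _ _ (by decide) (by decide)
  have trBC : (B * C).trace = 0 := hKK _ _ (by decide) (by decide)
  have trCA : (C * A).trace = 0 := hKK _ _ (by decide) (by decide)
  have trCB : (C * B).trace = 0 := hKK _ _ (by decide) (by decide)
  have hAQ : A * Q * Aᴴ = Q :=
    mul_sum_mul_conjTranspose trA trB trC (hKdet _) (hKdet _) (hKdet _) trAB trAC trBC
  have hBQ : B * Q * Bᴴ = Q := by
    have := mul_sum_mul_conjTranspose trB trA trC (hKdet _) (hKdet _) (hKdet _) trBA trBC trAC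
    rwa [show 1 + B * Bᴴ + A * Aᴴ + C * Cᴴ = Q by rw [hQ]; abel] at this
  have hCQ : C * Q * Cᴴ = Q := by
    have := mul_sum_mul_conjTranspose trC trA trB (hKdet _) (hKdet _) (hKdet _) trCA trCB trAB
    rwa [show 1 + C * Cᴴ + A * Aᴴ + B * Bᴴ = Q by rw [hQ]; abel] at this
  have hq0 : 0 < Q.det := hQpos.det_pos
  have hq : Q.det = (Q.det.re : ℂ) :=
    Complex.ext (by simp) (by simpa using (Complex.lt_def.1 hq0).2.symm)
  have hqr : 0 < Q.det.re := (Complex.lt_def.1 hq0).1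
  set Φ := (-G.adjugate)ᴴ * Q⁻¹ * symplecticTwo with hΦ
  have hΦdet : Φ 0 0 * Φ 1 1 - Φ 0 1 * Φ 1 0 = -(Q.det.re : ℂ)⁻¹ := by
    have h1 : (-G.adjugate).det = -1 := by
      rw [Matrix.det_neg, Matrix.det_adjugate, hG]
      simp
    rw [← Matrix.det_fin_two, hΦ, Matrix.det_mul, Matrix.det_mul, Matrix.det_conjTranspose, h1,
      det_symplecticTwo, Matrix.det_nonsing_inv, Ring.inverse_eq_inv', ← hq]
    simp
  have hterm (k) : (Matrix.of fun i j => X (i, j) k)ᴴ * Φ =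
      ((√(l k / 2) : ℝ) : ℂ) • ((K k)ᴴ * Q⁻¹ * symplecticTwo) := by
    have e : Gᴴ * (-G.adjugate)ᴴ = 1 := by
      rw [← Matrix.conjTranspose_mul, Matrix.neg_mul, Matrix.adjugate_mul, hG]
      simp
    rw [hM, Matrix.conjTranspose_smul, Matrix.conjTranspose_mul, hΦ, Matrix.smul_mul,
      Complex.star_def, Complex.conj_ofReal]
    congr 1
    calc _ = (K k)ᴴ * (Gᴴ * (-G.adjugate)ᴴ) * Q⁻¹ * symplecticTwo := by
          simp only [Matrix.mul_assoc]
      _ = _ := by rw [e, Matrix.mul_one]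
  have htrace (k) : (((Matrix.of fun i j => X (i, j) k)ᴴ * Φ) *
      ((Matrix.of fun i j => X (i, j) k)ᴴ * Φ).map star).trace =
      l k / 2 * (((K k)ᴴ * Q⁻¹ * symplecticTwo) *
        ((K k)ᴴ * Q⁻¹ * symplecticTwo).map star).trace := by
    have e (c : ℝ) (S : Matrix (Fin 2) (Fin 2) ℂ) :
        ((c : ℂ) • S).map star = (c : ℂ) • S.map star := by
      ext i j; simp
    rw [hterm, e, Matrix.smul_mul, Matrix.mul_smul, smul_smul, Matrix.trace_smul,
      ← Complex.ofReal_mul, Real.mul_self_sqrt (by linarith [hpos k]), smul_eq_mul]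
    push_cast
    rfl
  have hQA (k) (hk : (0, 0) ≠ k) (hkQ : K k * Q * (K k)ᴴ = Q) := trace_symplecticTwo_of_preserved
    hQpos hkQ (mul_self_eq_neg_one_of_trace (hKtr k hk) (hKdet k)) (hKdet k)
  have hsum := quadraticForm_partialTranspose h.1 Φ
  simp only [htrace, Fintype.sum_prod_type, Fin.sum_univ_two] at hsum
  rw [hQA _ (by decide) hAQ, hQA _ (by decide) hBQ, hQA _ (by decide) hCQ, hK0,
    trace_symplecticTwo_one hQpos, hq] at hsum
  refine ⟨fun p => Φ p.1 p.2, ?_, ?_⟩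
  · simp only [hΦdet]
    exact neg_ne_zero.2 (inv_ne_zero (by exact_mod_cast hqr.ne'))
  · simp only [hΦdet, norm_neg, norm_inv, Complex.norm_real, Real.norm_eq_abs, abs_of_pos hqr]
    have h3 : star (fun p : Fin 2 × Fin 2 => Φ p.1 p.2) ⬝ᵥ
        (partialTranspose ρ *ᵥ fun p : Fin 2 × Fin 2 => Φ p.1 p.2) =
        ((-(Q.det.re⁻¹ * (l (0, 0) - l (0, 1) - l (1, 0) - l (1, 1))) : ℝ) : ℂ) := by
      rw [hsum]; push_cast; ring
    rw [h3, Complex.ofReal_re]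

/-! ### A product basis realising the concurrence -/

theorem exists_localConj_concurrence_le_of_posDef {ρ X : TwoQubitOp} {l : Fin 2 × Fin 2 → ℝ}
    (hρ : ρ.PosDef) (h : IsTakagi ρ X l) :
    ∃ U V : Matrix.unitaryGroup (Fin 2) ℂ,
      l (0, 0) - l (0, 1) - l (1, 0) - l (1, 1) +
        2 * √(population (localConj U V ρ) 0 0 * population (localConj U V ρ) 1 1) ≤
      2 * coherence (localConj U V ρ) := by
  have hpos (k) : 0 < l k := by
    refine lt_of_le_of_ne (h.2.2.1 k) fun h0 => ?_
    have hX : X.det ≠ 0 := by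
      have := hρ.det_pos.ne'
      rw [← h.1, Matrix.det_mul] at this
      exact left_ne_zero_of_mul this
    have hY : spinForm.det ≠ 0 := by
      rw [spinForm, Matrix.det_kronecker]
      simp [pauliY, Matrix.det_fin_two]
    have h1 := congrArg Matrix.det h.2.1
    rw [Matrix.det_mul, Matrix.det_mul, Matrix.det_transpose, Matrix.det_diagonal,
      Finset.prod_eq_zero (Finset.mem_univ k) (by rw [← h0, Complex.ofReal_zero])] at h1
    exact mul_ne_zero (mul_ne_zero hX hY) hX h1
  obtain ⟨φ, hφ, hq⟩ := h.exists_quadraticForm_eq hpos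
  obtain ⟨U, V, a, b, ha, hb, -, hab, hle⟩ := exists_localConj_le_quadraticForm hρ.1 φ
  refine ⟨U, V, ?_⟩
  have hσ : (localConj U V ρ).PosSemidef := hρ.posSemidef.mul_mul_conjTranspose_same _
  have hp0 := population_nonneg hσ 0 0
  have hp1 := population_nonneg hσ 1 1
  rw [hq, ← hab] at hle
  have hab0 : 0 < a * b := by rw [hab]; exact norm_pos_iff.2 hφ
  set p := population (localConj U V ρ) 0 0
  set r := population (localConj U V ρ) 1 1
  have hamgm : 2 * (a * b) * √(p * r) ≤ a ^ 2 * p + b ^ 2 * r := by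
    rw [Real.sqrt_mul hp0]
    have e1 := Real.sq_sqrt hp0
    have e2 := Real.sq_sqrt hp1
    nlinarith [sq_nonneg (a * √p - b * √r)]
  refine le_of_mul_le_mul_left ?_ hab0
  linarith

/-- If the concurrence is positive, the bound `two_mul_coherence_le_concurrence` is attained in some
product basis. For invertible `ρ` this is `exists_localConj_concurrence_le_of_posDef`; the general
case follows by applying it to `ρ + ε` and letting `ε` tend to `0`, since Takagi decompositions and
product bases range over a compact set. -/
theorem exists_localConj_concurrence_le {ρ : TwoQubitOp} (hρ : IsState ρ)
    (hC : 0 < concurrence ρ) : ∃ U V : Matrix.unitaryGroup (Fin 2) ℂ,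
      concurrence ρ +
        2 * √(population (localConj U V ρ) 0 0 * population (localConj U V ρ) 1 1) ≤
      2 * coherence (localConj U V ρ) := by
  let T : TwoQubitOp → TwoQubitOp := fun X => Xᵀ * spinForm * X
  let ρε : ℝ → TwoQubitOp := fun ε => ρ + (ε : ℂ) • 1
  let σ : Matrix (Fin 2) (Fin 2) ℂ → Matrix (Fin 2) (Fin 2) ℂ → ℝ → TwoQubitOp :=
    fun U V ε => (U ⊗ₖ V) * ρε ε * (U ⊗ₖ V)ᴴ
  let box (n : Type) (r : ℝ) : Set (Matrix n n ℂ) :=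
    Set.univ.pi fun _ => Set.univ.pi fun _ => Metric.closedBall (0 : ℂ) r
  have hbox (n : Type) [Fintype n] (r : ℝ) : IsCompact (box n r) :=
    isCompact_univ_pi fun _ => isCompact_univ_pi fun _ => isCompact_closedBall _ _
  -- the set of all Takagi decompositions of some `ρ + ε` together with a suitable product basis
  let S : Set (TwoQubitOp × Matrix (Fin 2) (Fin 2) ℂ × Matrix (Fin 2) (Fin 2) ℂ × ℝ) :=
    {x | (x.1 * x.1ᴴ = ρε x.2.2.2 ∧ T x.1 = Matrix.diagonal (fun k => ((T x.1 k k).re : ℂ)) ∧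
        (∀ k, 0 ≤ (T x.1 k k).re) ∧ ∀ k, (T x.1 k k).re ≤ (T x.1 (0, 0) (0, 0)).re) ∧
      star x.2.1 * x.2.1 = 1 ∧ star x.2.2.1 * x.2.2.1 = 1 ∧
      (T x.1 (0, 0) (0, 0)).re - (T x.1 (0, 1) (0, 1)).re - (T x.1 (1, 0) (1, 0)).re -
        (T x.1 (1, 1) (1, 1)).re +
        2 * √(population (σ x.2.1 x.2.2.1 x.2.2.2) 0 0 * population (σ x.2.1 x.2.2.1 x.2.2.2) 1 1)
        ≤ 2 * coherence (σ x.2.1 x.2.2.1 x.2.2.2)}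
  let B : Set (TwoQubitOp × Matrix (Fin 2) (Fin 2) ℂ × Matrix (Fin 2) (Fin 2) ℂ × ℝ) :=
    box (Fin 2 × Fin 2) 2 ×ˢ box (Fin 2) 1 ×ˢ box (Fin 2) 1 ×ˢ Set.Icc 0 1
  have hB : IsCompact B := (hbox _ _).prod ((hbox _ _).prod ((hbox _ _).prod isCompact_Icc))
  have hS : IsClosed S := by
    have cT : Continuous fun x : TwoQubitOp × Matrix (Fin 2) (Fin 2) ℂ × Matrix (Fin 2) (Fin 2) ℂ × ℝ
        => T x.1 :=
      (continuous_fst.matrix_transpose.matrix_mul continuous_const).matrix_mul continuous_fst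
    have cTr (p q : Fin 2 × Fin 2) : Continuous fun x : TwoQubitOp × Matrix (Fin 2) (Fin 2) ℂ ×
        Matrix (Fin 2) (Fin 2) ℂ × ℝ => (T x.1 p q).re :=
      Complex.continuous_re.comp (cT.matrix_elem p q)
    have cρ : Continuous fun x : TwoQubitOp × Matrix (Fin 2) (Fin 2) ℂ × Matrix (Fin 2) (Fin 2) ℂ × ℝ
        => ρε x.2.2.2 := by
      have cε : Continuous fun x : TwoQubitOp × Matrix (Fin 2) (Fin 2) ℂ ×
        Matrix (Fin 2) (Fin 2) ℂ × ℝ => (x.2.2.2 : ℂ) :=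
        Complex.continuous_ofReal.comp (by fun_prop)
      exact continuous_const.add (cε.smul continuous_const)
    have cUV : Continuous fun x : TwoQubitOp × Matrix (Fin 2) (Fin 2) ℂ × Matrix (Fin 2) (Fin 2) ℂ × ℝ
        => x.2.1 ⊗ₖ x.2.2.1 := by
      refine continuous_matrix fun p q => ?_
      simp only [Matrix.kroneckerMap_apply]
      have c1 : Continuous fun x : TwoQubitOp × Matrix (Fin 2) (Fin 2) ℂ ×
        Matrix (Fin 2) (Fin 2) ℂ × ℝ => x.2.1 := by fun_prop
      have c2 : Continuous fun x : TwoQubitOp × Matrix (Fin 2) (Fin 2) ℂ ×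
        Matrix (Fin 2) (Fin 2) ℂ × ℝ => x.2.2.1 := by fun_prop
      exact (c1.matrix_elem _ _).mul (c2.matrix_elem _ _)
    have cσ : Continuous fun x : TwoQubitOp × Matrix (Fin 2) (Fin 2) ℂ × Matrix (Fin 2) (Fin 2) ℂ × ℝ
        => σ x.2.1 x.2.2.1 x.2.2.2 :=
      (cUV.matrix_mul cρ).matrix_mul cUV.matrix_conjTranspose
    have cp (i j : Fin 2) : Continuous fun x : TwoQubitOp × Matrix (Fin 2) (Fin 2) ℂ ×
        Matrix (Fin 2) (Fin 2) ℂ × ℝ => population (σ x.2.1 x.2.2.1 x.2.2.2) i j :=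
      Complex.continuous_re.comp (cσ.matrix_elem _ _)
    have cc : Continuous fun x : TwoQubitOp × Matrix (Fin 2) (Fin 2) ℂ ×
        Matrix (Fin 2) (Fin 2) ℂ × ℝ => coherence (σ x.2.1 x.2.2.1 x.2.2.2) :=
      (cσ.matrix_elem _ _).norm
    have c1 : Continuous fun x : TwoQubitOp × Matrix (Fin 2) (Fin 2) ℂ ×
        Matrix (Fin 2) (Fin 2) ℂ × ℝ => x.2.1 := by fun_prop
    have c2 : Continuous fun x : TwoQubitOp × Matrix (Fin 2) (Fin 2) ℂ ×
        Matrix (Fin 2) (Fin 2) ℂ × ℝ => x.2.2.1 := by fun_prop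
    refine IsClosed.and (IsClosed.and (isClosed_eq (continuous_fst.matrix_mul
      continuous_fst.matrix_conjTranspose) cρ) (IsClosed.and (isClosed_eq cT ?_) (IsClosed.and ?_ ?_)))
      (IsClosed.and (isClosed_eq (c1.matrix_conjTranspose.matrix_mul c1) continuous_const)
      (IsClosed.and (isClosed_eq (c2.matrix_conjTranspose.matrix_mul c2) continuous_const)
      (isClosed_le ?_ (continuous_const.mul cc))))
    · exact Continuous.matrix_diagonal
        (continuous_pi fun k => Complex.continuous_ofReal.comp (cTr k k))
    · simp only [Set.ofPred_forall]
      exact isClosed_iInter fun k => isClosed_le continuous_const (cTr k k)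
    · simp only [Set.ofPred_forall]
      exact isClosed_iInter fun k => isClosed_le (cTr k k) (cTr _ _)
    · exact ((((cTr _ _).sub (cTr _ _)).sub (cTr _ _)).sub (cTr _ _)).add
        (continuous_const.mul ((cp 0 0).mul (cp 1 1)).sqrt)
  have himg : IsClosed ((fun x => x.2.2.2) '' (S ∩ B)) :=
    ((hB.inter_left hS).image (by fun_prop)).isClosed
  have hIoc : Set.Ioc (0 : ℝ) 1 ⊆ (fun x => x.2.2.2) '' (S ∩ B) := by
    intro ε hε
    have hpd : (ρε ε).PosDef :=
      Matrix.PosDef.posSemidef_add hρ.1 (Matrix.PosDef.one.smul (by exact_mod_cast hε.1))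
    obtain ⟨X, l, hX⟩ := exists_isTakagi hpd.posSemidef
    obtain ⟨U, V, hUV⟩ := exists_localConj_concurrence_le_of_posDef hpd hX
    have hT (k) : (T X k k).re = l k := by
      have : T X k k = (l k : ℂ) := by simp only [T]; rw [hX.2.1, Matrix.diagonal_apply_eq]
      rw [this, Complex.ofReal_re]
    have hunit (W : Matrix.unitaryGroup (Fin 2) ℂ) : W.1 ∈ box (Fin 2) 1 := fun i _ j _ => by
      rw [mem_closedBall_zero_iff]; exact entry_norm_bound_of_unitary W.2 i j
    refine ⟨(X, U.1, V.1, ε), ⟨⟨⟨hX.1, ?_, ?_, ?_⟩, Matrix.mem_unitaryGroup_iff'.1 U.2,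
      Matrix.mem_unitaryGroup_iff'.1 V.2, ?_⟩, ?_, hunit U, hunit V, hε.1.le, hε.2⟩, rfl⟩
    · simp only [hT]; exact hX.2.1
    · simp only [hT]; exact hX.2.2.1
    · simp only [hT]; exact hX.2.2.2
    · simp only [hT]; exact hUV
    · rintro ⟨i, j⟩ - k -
      rw [mem_closedBall_zero_iff]
      refine abs_le_of_sq_le_sq' ?_ zero_le_two |>.2
      have h1 : ‖X (i, j) k‖ ^ 2 ≤ population (ρε ε) i j := by
        rw [population_eq_sum hX.1]
        exact Finset.single_le_sum (f := fun k => ‖X (i, j) k‖ ^ 2) (fun _ _ => sq_nonneg _)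
          (Finset.mem_univ k)
      have h2 : population (ρε ε) i j = population ρ i j + ε := by
        simp [population, ρε]
      have h3 : population ρ i j ≤ 1 := by
        have := hρ.sum_population
        have h00 := population_nonneg hρ.1 0 0
        have h01 := population_nonneg hρ.1 0 1
        have h10 := population_nonneg hρ.1 1 0
        have h11 := population_nonneg hρ.1 1 1
        fin_cases i <;> fin_cases j <;> simp <;> linarith
      linarith [hε.2]
  have h0 : (0 : ℝ) ∈ (fun x => x.2.2.2) '' (S ∩ B) := by
    refine himg.closure_subset_iff.2 hIoc ?_
    rw [closure_Ioc zero_ne_one]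
    exact ⟨le_rfl, zero_le_one⟩
  obtain ⟨⟨X, U, V, ε⟩, ⟨⟨⟨hX1, hX2, hX3, hX4⟩, hU, hV, hle⟩, -⟩, hε⟩ := h0
  obtain rfl : ε = 0 := hε
  have hρ0 : ρε 0 = ρ := by simp [ρε]
  have hT : IsTakagi ρ X fun k => (T X k k).re := ⟨hX1.trans hρ0, hX2, hX3, hX4⟩
  have hCeq := hT.concurrence
  rw [hCeq] at hC
  rw [max_eq_right (by by_contra hcon; rw [max_eq_left (not_le.1 hcon).le] at hC; exact hC.false)]
    at hCeq
  refine ⟨⟨U, Matrix.mem_unitaryGroup_iff'.2 hU⟩, ⟨V, Matrix.mem_unitaryGroup_iff'.2 hV⟩, ?_⟩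
  simp only [σ, hρ0] at hle
  rw [hCeq]
  exact hle

/-! ### Lower bounds on the fidelity -/

/-- The least fidelity for given negativity. -/
noncomputable def negativityBound (N : ℝ) : ℝ :=
  max (1 / 4 + (N + √(5 * N ^ 2 + 4 * N)) / 8) (√(2 * N * (N + 1)) - N)

/-- The least fidelity for given concurrence. -/
noncomputable def concurrenceBound (C : ℝ) : ℝ := max ((1 + C) / 4) C

/-- The constraints on a state that only involve its populations and coherence in one product
basis. -/
theorem fidelity_constraints {ρ : TwoQubitOp} (hρ : IsState ρ)
    (U V : Matrix.unitaryGroup (Fin 2) ℂ) :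
    0 ≤ population (localConj U V ρ) 0 0 ∧ 0 ≤ population (localConj U V ρ) 1 1 ∧
    0 ≤ coherence (localConj U V ρ) ∧
    2 * coherence (localConj U V ρ) ≤
      1 - (population (localConj U V ρ) 0 0 + population (localConj U V ρ) 1 1) ∧
    (1 - (population (localConj U V ρ) 0 0 + population (localConj U V ρ) 1 1)) / 2 +
      coherence (localConj U V ρ) ≤ fidelity ρ ∧
    (population (localConj U V ρ) 0 0 + population (localConj U V ρ) 1 1) / 2 ≤ fidelity ρ := by
  have hσ := hρ.localConj U V
  have h1 := hσ.sum_population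
  have h2 := two_mul_coherence_le hσ.1
  have h3 := antiparallel_le_fidelity hσ
  have h4 := parallel_le_fidelity hσ
  rw [fidelity_localConj] at h3 h4
  exact ⟨population_nonneg hσ.1 0 0, population_nonneg hσ.1 1 1, coherence_nonneg _, by linarith,
    by linarith, h4⟩

theorem one_fourth_le_fidelity {ρ : TwoQubitOp} (hρ : IsState ρ) : 1 / 4 ≤ fidelity ρ := by
  obtain ⟨-, -, h1, -, h2, h3⟩ := fidelity_constraints hρ 1 1
  linarith

theorem low_bound_le {N F : ℝ} (h1 : N ≤ 4 * F - 1) (hN : 0 ≤ N)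
    (h2 : N ^ 2 + 4 * N * F ≤ (4 * F - 1) ^ 2) :
    1 / 4 + (N + √(5 * N ^ 2 + 4 * N)) / 8 ≤ F := by
  have : √(5 * N ^ 2 + 4 * N) ≤ 8 * F - 2 - N :=
    Real.sqrt_le_iff.2 ⟨by linarith, by nlinarith⟩
  linarith

theorem le_low_bound {N F : ℝ} (h : (4 * F - 1) ^ 2 ≤ N ^ 2 + 4 * N * F) :
    F ≤ 1 / 4 + (N + √(5 * N ^ 2 + 4 * N)) / 8 := by
  have : 8 * F - 2 - N ≤ √(5 * N ^ 2 + 4 * N) := Real.le_sqrt_of_sq_le (by nlinarith)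
  linarith

theorem sq_le_of_low_bound_le {N F : ℝ}
    (h : 1 / 4 + (N + √(5 * N ^ 2 + 4 * N)) / 8 ≤ F) :
    N ^ 2 + 4 * N * F ≤ (4 * F - 1) ^ 2 := by
  have h1 : √(5 * N ^ 2 + 4 * N) ≤ 8 * F - 2 - N := by linarith
  have := (Real.sqrt_le_iff.1 h1).2
  nlinarith

theorem high_bound_le {N F : ℝ} (hN : 0 ≤ N) (hF : 0 ≤ F)
    (h : N ^ 2 + 2 * N ≤ F ^ 2 + 2 * N * F) : √(2 * N * (N + 1)) - N ≤ F := by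
  have : √(2 * N * (N + 1)) ≤ F + N := Real.sqrt_le_iff.2 ⟨by linarith, by nlinarith⟩
  linarith

theorem le_high_bound {N F : ℝ} (h : F ^ 2 + 2 * N * F ≤ N ^ 2 + 2 * N) :
    F ≤ √(2 * N * (N + 1)) - N := by
  have : F + N ≤ √(2 * N * (N + 1)) := Real.le_sqrt_of_sq_le (by nlinarith)
  linarith

theorem sq_le_of_high_bound_le {N F : ℝ} (h : √(2 * N * (N + 1)) - N ≤ F) :
    N ^ 2 + 2 * N ≤ F ^ 2 + 2 * N * F := by
  have h1 : √(2 * N * (N + 1)) ≤ F + N := by linarith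
  have := (Real.sqrt_le_iff.1 h1).2
  nlinarith

/-- The fidelity is bounded below in terms of the negativity. In a product basis that realises the
negativity this is an inequality between real numbers: `p, q` are the populations of `00`
and `11`, and `y` is twice the coherence. -/
theorem negativityBound_le_fidelity {ρ : TwoQubitOp} (hρ : IsState ρ) :
    negativityBound (negativity ρ) ≤ fidelity ρ := by
  have hF := one_fourth_le_fidelity hρ
  rcases (negativity_nonneg ρ).eq_or_lt with h0 | hN
  · rw [← h0, negativityBound]
    norm_num
    linarith
  obtain ⟨U, V, h⟩ := exists_localConj_negativity_le hρ hN
  obtain ⟨hp, hq, hy, h1, h2, h3⟩ := fidelity_constraints hρ U V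
  set p := population (localConj U V ρ) 0 0
  set q := population (localConj U V ρ) 1 1
  set F := fidelity ρ
  set N := negativity ρ
  obtain ⟨y, hyd⟩ : ∃ y, y = 2 * coherence (localConj U V ρ) := ⟨_, rfl⟩
  rw [← hyd] at h h1
  obtain ⟨r, hr⟩ : ∃ r, r = p + q := ⟨_, rfl⟩
  rw [← hr] at h1 h2 h3
  replace h : N ^ 2 + 2 * N * r ≤ y ^ 2 := by
    rw [hr]; nlinarith [mul_nonneg hp hq]
  have hr0 : 0 ≤ r := by linarith
  have hNy : N ≤ y :=
    abs_le_of_sq_le_sq' (by nlinarith [mul_nonneg hN.le hr0]) (by linarith) |>.2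
  have hyF : y ≤ 2 * F - 1 + r := by linarith
  refine max_le (low_bound_le (by linarith) hN.le ?_) (high_bound_le hN.le (by linarith) ?_)
  · have e1 : y ^ 2 ≤ (2 * F - 1 + r) ^ 2 := pow_le_pow_left₀ (by linarith) hyF 2
    nlinarith [mul_nonneg (by linarith : 0 ≤ 2 * F - r) (by linarith : 0 ≤ 6 * F - 2 + r - 2 * N)]
  · -- `e` is the amount by which the coherence stays below its maximum
    obtain ⟨e, he⟩ : ∃ e, e = (1 - r - y) / 2 := ⟨_, rfl⟩
    have he0 : 0 ≤ e := by linarith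
    have hFe : y + e ≤ F := by linarith
    have e1 : (y + e) ^ 2 ≤ F ^ 2 := pow_le_pow_left₀ (by linarith) hFe 2
    have e2 : N * (y + e) ≤ N * F := mul_le_mul_of_nonneg_left hFe hN.le
    have e3 := mul_nonneg he0 (sub_nonneg.2 hNy)
    have e4 : r = 1 - y - 2 * e := by linarith
    rw [e4] at h
    nlinarith [sq_nonneg e]

theorem concurrenceBound_le_fidelity {ρ : TwoQubitOp} (hρ : IsState ρ) :
    concurrenceBound (concurrence ρ) ≤ fidelity ρ := by
  have hF := one_fourth_le_fidelity hρ
  rcases (concurrence_nonneg ρ).eq_or_lt with h0 | hC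
  · rw [← h0, concurrenceBound]
    norm_num
    linarith
  obtain ⟨U, V, h⟩ := exists_localConj_concurrence_le hρ hC
  obtain ⟨hp, hq, hy, h1, h2, h3⟩ := fidelity_constraints hρ U V
  have := Real.sqrt_nonneg (population (localConj U V ρ) 0 0 * population (localConj U V ρ) 1 1)
  exact max_le (by linarith) (by linarith)

/-- Equality in `negativityBound_le_fidelity` forces the state to have as large a coherence as
possible in the product basis that realises the negativity, so it has large concurrence. -/
theorem fidelity_le_concurrenceBound {ρ : TwoQubitOp} (hρ : IsState ρ)
    (hmin : fidelity ρ = negativityBound (negativity ρ)) :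
    fidelity ρ ≤ concurrenceBound (concurrence ρ) := by
  rcases (negativity_nonneg ρ).eq_or_lt with h0 | hN
  · have hC := concurrence_nonneg ρ
    rw [hmin, ← h0, negativityBound]
    refine le_trans ?_ (le_max_left _ _)
    norm_num
    linarith
  obtain ⟨U, V, h⟩ := exists_localConj_negativity_le hρ hN
  have hconc := two_mul_coherence_localConj_le_concurrence hρ U V
  obtain ⟨hp, hq, hy, h1, h2, h3⟩ := fidelity_constraints hρ U V
  set p := population (localConj U V ρ) 0 0
  set q := population (localConj U V ρ) 1 1
  set F := fidelity ρ
  set N := negativity ρ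
  obtain ⟨y, hyd⟩ : ∃ y, y = 2 * coherence (localConj U V ρ) := ⟨_, rfl⟩
  rw [← hyd] at h h1 hconc
  obtain ⟨r, hr⟩ : ∃ r, r = p + q := ⟨_, rfl⟩
  obtain ⟨s, hs⟩ : ∃ s, s = p * q := ⟨_, rfl⟩
  have hs0 : 0 ≤ s := by rw [hs]; exact mul_nonneg hp hq
  rw [← hr] at h1 h2 h3
  rw [← hs] at hconc
  replace h : N ^ 2 + 2 * N * r + 4 * s ≤ y ^ 2 := by rw [hr, hs]; nlinarith
  have hr0 : 0 ≤ r := by linarith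
  have hNy : N ≤ y :=
    abs_le_of_sq_le_sq' (by nlinarith [mul_nonneg hN.le hr0]) (by linarith) |>.2
  have hyF : y ≤ 2 * F - 1 + r := by linarith
  rcases le_total (√(2 * N * (N + 1)) - N) (1 / 4 + (N + √(5 * N ^ 2 + 4 * N)) / 8) with hc | hc
  · rw [negativityBound, max_eq_left hc] at hmin
    have hlow : (4 * F - 1) ^ 2 ≤ N ^ 2 + 4 * N * F := by
      have hsq := Real.sq_sqrt (by positivity : 0 ≤ 5 * N ^ 2 + 4 * N)
      have hval : √(5 * N ^ 2 + 4 * N) = 8 * F - 2 - N := by linarith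
      rw [hval] at hsq
      nlinarith
    have hF4 : N < 4 * F - 1 := by
      have : N < √(5 * N ^ 2 + 4 * N) := Real.lt_sqrt_of_sq_lt (by nlinarith)
      linarith
    have e1 : y ^ 2 ≤ (2 * F - 1 + r) ^ 2 := pow_le_pow_left₀ (by linarith) hyF 2
    have e2 : 4 * s + (2 * F - r) * (6 * F - 2 + r - 2 * N) ≤ 0 := by nlinarith
    have e3 : 0 ≤ (2 * F - r) * (6 * F - 2 + r - 2 * N) :=
      mul_nonneg (by linarith) (by linarith)
    have e4 : s = 0 := by linarith
    have e5 : 2 * F - r = 0 := by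
      rcases mul_eq_zero.1 (le_antisymm (by linarith) e3) with h' | h'
      · exact h'
      · linarith
    rw [e4, Real.sqrt_zero] at hconc
    have e6 : 4 * F - 1 ≤ y := by
      refine abs_le_of_sq_le_sq' ?_ (by linarith) |>.2
      nlinarith
    exact le_trans (by linarith) (le_max_left _ _)
  · rw [negativityBound, max_eq_right hc] at hmin
    have hhigh : F ^ 2 + 2 * N * F ≤ N ^ 2 + 2 * N := by
      have hsq := Real.sq_sqrt (by positivity : 0 ≤ 2 * N * (N + 1))
      have hval : √(2 * N * (N + 1)) = F + N := by linarith
      rw [hval] at hsq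
      nlinarith
    obtain ⟨e, he⟩ : ∃ e, e = (1 - r - y) / 2 := ⟨_, rfl⟩
    have he0 : 0 ≤ e := by linarith
    have hFe : y + e ≤ F := by linarith
    have e1 : (y + e) ^ 2 ≤ F ^ 2 := pow_le_pow_left₀ (by linarith) hFe 2
    have e2 : N * (y + e) ≤ N * F := mul_le_mul_of_nonneg_left hFe hN.le
    have e3 := mul_nonneg he0 (sub_nonneg.2 hNy)
    have e4 : r = 1 - y - 2 * e := by linarith
    rw [e4] at h
    have e5 : 4 * s + e ^ 2 ≤ 0 := by linarith
    have e6 : e = 0 := pow_eq_zero_iff two_ne_zero |>.1 (by linarith [sq_nonneg e])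
    have e7 : s = 0 := by linarith [sq_nonneg e]
    subst e6
    rw [e7, Real.sqrt_zero] at hconc
    have e8 : F ≤ y := by
      by_contra hlt
      have := mul_pos (sub_pos.2 (not_le.1 hlt)) (by linarith : 0 < F + y + 2 * N)
      linarith
    exact le_trans (by linarith) (le_max_right _ _)

/-- Equality in `concurrenceBound_le_fidelity` determines the populations and the coherence in the
product basis that realises the concurrence, and with them a lower bound on the negativity. -/
theorem fidelity_le_negativityBound {ρ : TwoQubitOp} (hρ : IsState ρ)
    (hmin : fidelity ρ = concurrenceBound (concurrence ρ)) :
    fidelity ρ ≤ negativityBound (negativity ρ) := by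
  have hN := negativity_nonneg ρ
  rcases (concurrence_nonneg ρ).eq_or_lt with h0 | hC
  · rw [hmin, ← h0, concurrenceBound]
    refine le_trans ?_ (le_max_left _ _)
    have := Real.sqrt_nonneg (5 * negativity ρ ^ 2 + 4 * negativity ρ)
    norm_num
    linarith
  obtain ⟨U, V, h⟩ := exists_localConj_concurrence_le hρ hC
  have hneg := coherence_sq_le_negativity hρ.1.1 U V
  obtain ⟨hp, hq, hy, h1, h2, h3⟩ := fidelity_constraints hρ U V
  set p := population (localConj U V ρ) 0 0
  set q := population (localConj U V ρ) 1 1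
  set F := fidelity ρ
  set N := negativity ρ
  set C := concurrence ρ
  have hs0 : 0 ≤ √(p * q) := Real.sqrt_nonneg _
  have hzero (h : √(p * q) ≤ 0) : p * q = 0 :=
    le_antisymm (Real.sqrt_eq_zero'.1 (le_antisymm h hs0)) (mul_nonneg hp hq)
  rcases le_total C ((1 + C) / 4) with hc | hc
  · rw [concurrenceBound, max_eq_left hc] at hmin
    have e0 := hzero (by linarith)
    have e1 : 2 * coherence (localConj U V ρ) = 4 * F - 1 := by linarith
    have e2 : p + q = 2 * F := by linarith
    rw [e1] at hneg
    refine (le_low_bound ?_).trans (le_max_left _ _)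
    nlinarith
  · rw [concurrenceBound, max_eq_right hc] at hmin
    have e0 := hzero (by linarith)
    have e1 : 2 * coherence (localConj U V ρ) = F := by linarith
    have e2 : p + q = 1 - F := by linarith
    rw [e1] at hneg
    refine (le_high_bound ?_).trans (le_max_right _ _)
    nlinarith

theorem fidelity_eq_negativityBound_iff {ρ : TwoQubitOp} (hρ : IsState ρ) :
    fidelity ρ = negativityBound (negativity ρ) ↔
      fidelity ρ = concurrenceBound (concurrence ρ) :=
  ⟨fun h => (fidelity_le_concurrenceBound hρ h).antisymm (concurrenceBound_le_fidelity hρ),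
    fun h => (fidelity_le_negativityBound hρ h).antisymm (negativityBound_le_fidelity hρ)⟩

theorem negativity_le_one {ρ : TwoQubitOp} (hρ : IsState ρ) : negativity ρ ≤ 1 := by
  rcases (negativity_nonneg ρ).eq_or_lt with h0 | hN
  · rw [← h0]; exact zero_le_one
  obtain ⟨U, V, h⟩ := exists_localConj_negativity_le hρ hN
  obtain ⟨hp, hq, hy, h1, -, -⟩ := fidelity_constraints hρ U V
  have e1 : negativity ρ ^ 2 ≤ (2 * coherence (localConj U V ρ)) ^ 2 := by
    nlinarith [mul_nonneg hp hq, mul_nonneg hN.le hp, mul_nonneg hN.le hq]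
  have := abs_le_of_sq_le_sq' e1 (by linarith) |>.2
  linarith

theorem concurrence_le_one {ρ : TwoQubitOp} (hρ : IsState ρ) : concurrence ρ ≤ 1 := by
  have h1 := (le_max_right _ _).trans (concurrenceBound_le_fidelity hρ)
  have h2 := fidelity_le_of_negativity hρ
  have h3 := negativity_le_one hρ
  linarith

/-! ### States with a single coherence -/

/-- The operator with populations `a, b, c, 0` and coherence `z` between `01` and `10`; both
explicit families are of this form. -/
noncomputable def singleCoherence (a b c z : ℝ) : TwoQubitOp :=
  ofRealMatrix !![a, 0, 0, 0; 0, b, z, 0; 0, z, c, 0; 0, 0, 0, 0]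

theorem singleCoherence_apply (a b c z : ℝ) (p q : Fin 2 × Fin 2) :
    singleCoherence a b c z p q = if p = (0, 0) ∧ q = (0, 0) then (a : ℂ) else
      if p = (0, 1) ∧ q = (0, 1) then (b : ℂ) else if p = (1, 0) ∧ q = (1, 0) then (c : ℂ) else
      if (p = (0, 1) ∧ q = (1, 0)) ∨ (p = (1, 0) ∧ q = (0, 1)) then (z : ℂ) else 0 := by
  have e00 : (finProdFinEquiv ((0, 0) : Fin 2 × Fin 2) : Fin 4) = 0 := rfl
  have e01 : (finProdFinEquiv ((0, 1) : Fin 2 × Fin 2) : Fin 4) = 1 := rfl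
  have e10 : (finProdFinEquiv ((1, 0) : Fin 2 × Fin 2) : Fin 4) = 2 := rfl
  have e11 : (finProdFinEquiv ((1, 1) : Fin 2 × Fin 2) : Fin 4) = 3 := rfl
  obtain ⟨i, j⟩ := p
  obtain ⟨k, l⟩ := q
  fin_cases i <;> fin_cases j <;> fin_cases k <;> fin_cases l <;>
    simp [singleCoherence, ofRealMatrix, e00, e01, e10, e11]

theorem quadraticForm_singleCoherence (a b c z : ℝ) (ψ : Fin 2 × Fin 2 → ℂ) :
    star ψ ⬝ᵥ (singleCoherence a b c z *ᵥ ψ) =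
      ((a * ‖ψ (0, 0)‖ ^ 2 + b * ‖ψ (0, 1)‖ ^ 2 + c * ‖ψ (1, 0)‖ ^ 2 +
        2 * z * (star (ψ (0, 1)) * ψ (1, 0)).re : ℝ) : ℂ) := by
  rw [quadraticForm_eq_sum]
  have e (w : ℂ) : (starRingEnd ℂ) w * w = ((‖w‖ : ℝ) : ℂ) ^ 2 := by
    rw [← Complex.normSq_eq_conj_mul_self, Complex.normSq_eq_norm_sq]; push_cast; rfl
  have e2 : (2 * (star (ψ (0, 1)) * ψ (1, 0)).re : ℂ) =
      star (ψ (0, 1)) * ψ (1, 0) + star (ψ (1, 0)) * ψ (0, 1) := by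
    have := Complex.add_conj (star (ψ (0, 1)) * ψ (1, 0))
    rw [map_mul, Complex.star_def, Complex.conj_conj] at this
    rw [Complex.star_def]
    push_cast at this
    linear_combination -this
  simp only [Fintype.sum_prod_type, Fin.sum_univ_two, singleCoherence_apply]
  simp only [Complex.ofReal_add, Complex.ofReal_mul, Complex.ofReal_pow, Complex.ofReal_ofNat,
    ← e]
  simp at e2 ⊢
  linear_combination -z * e2

theorem isState_singleCoherence {a b c z : ℝ} (ha : 0 ≤ a) (hb : 0 ≤ b) (hc : 0 ≤ c)
    (hz : z ^ 2 ≤ b * c) (h : a + b + c = 1) : IsState (singleCoherence a b c z) := by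
  refine ⟨Matrix.PosSemidef.of_dotProduct_mulVec_nonneg ?_ fun ψ => ?_, ?_⟩
  · ext ⟨i, j⟩ ⟨k, l⟩
    rw [Matrix.conjTranspose_apply, singleCoherence_apply, singleCoherence_apply]
    fin_cases i <;> fin_cases j <;> fin_cases k <;> fin_cases l <;> simp
  · rw [quadraticForm_singleCoherence]
    have h1 : |z * (star (ψ (0, 1)) * ψ (1, 0)).re| ≤ |z| * (‖ψ (0, 1)‖ * ‖ψ (1, 0)‖) := by
      rw [abs_mul]
      refine mul_le_mul_of_nonneg_left ((Complex.abs_re_le_norm _).trans ?_) (abs_nonneg _)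
      rw [norm_mul, norm_star]
    have h2 : 2 * (|z| * (‖ψ (0, 1)‖ * ‖ψ (1, 0)‖)) ≤
        b * ‖ψ (0, 1)‖ ^ 2 + c * ‖ψ (1, 0)‖ ^ 2 := by
      refine abs_le_of_sq_le_sq' ?_ (by positivity) |>.2
      rw [mul_pow, mul_pow, sq_abs]
      have := mul_le_mul_of_nonneg_right hz (sq_nonneg (‖ψ (0, 1)‖ * ‖ψ (1, 0)‖))
      nlinarith [sq_nonneg (b * ‖ψ (0, 1)‖ ^ 2 - c * ‖ψ (1, 0)‖ ^ 2)]
    have h3 := (abs_le.1 h1).1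
    have h4 : 0 ≤ a * ‖ψ (0, 0)‖ ^ 2 := by positivity
    have h5 : 0 ≤ a * ‖ψ (0, 0)‖ ^ 2 + b * ‖ψ (0, 1)‖ ^ 2 + c * ‖ψ (1, 0)‖ ^ 2 +
        2 * z * (star (ψ (0, 1)) * ψ (1, 0)).re := by linarith
    exact_mod_cast h5
  · rw [Matrix.trace, Fintype.sum_prod_type]
    simp [singleCoherence_apply]
    exact_mod_cast h

theorem fidelity_singleCoherence_le {a b c z x : ℝ} (h1 : a ≤ x) (h2 : b + c + 2 * |z| ≤ x) :
    fidelity (singleCoherence a b c z) ≤ x / 2 := by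
  refine fidelity_le fun ψ hψ => ?_
  rw [overlap, quadraticForm_singleCoherence, Complex.ofReal_re]
  have e (w : ℂ) : (starRingEnd ℂ) w * w = ((‖w‖ : ℝ) : ℂ) ^ 2 := by
    rw [← Complex.normSq_eq_conj_mul_self, Complex.normSq_eq_norm_sq]; push_cast; rfl
  have r0 : ‖ψ (0, 0)‖ ^ 2 + ‖ψ (0, 1)‖ ^ 2 = 1 / 2 := by
    have := hψ.row 0 0
    rw [Complex.star_def, mul_comm, mul_comm (ψ (0, 1)), e, e] at this
    simp only [if_true] at this
    have h := congrArg Complex.re this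
    norm_cast at h
    rw [h]; norm_num
  have c0 : ‖ψ (0, 0)‖ ^ 2 + ‖ψ (1, 0)‖ ^ 2 = 1 / 2 := by
    have := hψ.column 0 0
    rw [Complex.star_def, e, e] at this
    simp only [if_true] at this
    have h := congrArg Complex.re this
    norm_cast at h
    rw [h]; norm_num
  have h01 : ‖ψ (1, 0)‖ = ‖ψ (0, 1)‖ :=
    (sq_eq_sq₀ (norm_nonneg _) (norm_nonneg _)).1 (by linarith)
  have h3 : |z * (star (ψ (0, 1)) * ψ (1, 0)).re| ≤ |z| * ‖ψ (0, 1)‖ ^ 2 := by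
    rw [abs_mul, pow_two]
    refine mul_le_mul_of_nonneg_left ((Complex.abs_re_le_norm _).trans ?_) (abs_nonneg _)
    rw [norm_mul, norm_star, h01]
  have h4 := (abs_le.1 h3).2
  have h5 := mul_le_mul_of_nonneg_right h1 (sq_nonneg ‖ψ (0, 0)‖)
  have h6 := mul_le_mul_of_nonneg_right h2 (sq_nonneg ‖ψ (0, 1)‖)
  rw [h01]
  have h7 : x * ‖ψ (0, 0)‖ ^ 2 + x * ‖ψ (0, 1)‖ ^ 2 = x / 2 := by rw [← mul_add, r0]; ring
  linarith

theorem le_concurrence_singleCoherence {a b c z : ℝ} (h : IsState (singleCoherence a b c z)) :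
    2 * |z| ≤ concurrence (singleCoherence a b c z) := by
  have := two_mul_coherence_le_concurrence h.1
  simpa [coherence, population, singleCoherence_apply] using this

theorem sq_le_negativity_singleCoherence {a b c z : ℝ} (h : IsState (singleCoherence a b c z)) :
    (2 * z) ^ 2 ≤ (negativity (singleCoherence a b c z) + 2 * a) *
      negativity (singleCoherence a b c z) := by
  have := coherence_sq_le_negativity h.1.1 1 1
  rw [localConj_one] at this
  simpa [coherence, population, singleCoherence_apply, mul_pow] using this

/-! ### The two explicit families -/

theorem lowFamily_eq (C : ℝ) : lowFamily C = singleCoherence ((1 + C) / 2)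
    ((1 - C + √(1 - 2 * C - 3 * C ^ 2)) / 4) ((1 - C - √(1 - 2 * C - 3 * C ^ 2)) / 4) (-C / 2) :=
  rfl

theorem highFamily_eq (C : ℝ) : highFamily C = singleCoherence (1 - C) (C / 2) (C / 2) (-C / 2) :=
  rfl

theorem isState_lowFamily {C : ℝ} (h0 : 0 ≤ C) (h1 : C ≤ 1 / 3) : IsState (lowFamily C) := by
  have hd : 0 ≤ 1 - 2 * C - 3 * C ^ 2 := by nlinarith
  have hs := Real.sq_sqrt hd
  have hle : √(1 - 2 * C - 3 * C ^ 2) ≤ 1 - C :=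
    Real.sqrt_le_iff.2 ⟨by linarith, by nlinarith⟩
  have hs0 := Real.sqrt_nonneg (1 - 2 * C - 3 * C ^ 2)
  exact isState_singleCoherence (by linarith) (by linarith) (by linarith) (by nlinarith) (by ring)

theorem isState_highFamily {C : ℝ} (h0 : 1 / 3 ≤ C) (h1 : C ≤ 1) : IsState (highFamily C) :=
  isState_singleCoherence (by linarith) (by linarith) (by linarith) (by nlinarith) (by ring)

theorem concurrence_fidelity_lowFamily {C : ℝ} (h0 : 0 ≤ C) (h1 : C ≤ 1 / 3) :
    concurrence (lowFamily C) = C ∧ fidelity (lowFamily C) = (1 + C) / 4 := by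
  have hs := isState_lowFamily h0 h1
  have hz : |-C / 2| = C / 2 := by rw [neg_div, abs_neg, abs_of_nonneg (by linarith)]
  have e1 : C ≤ concurrence (lowFamily C) := by
    have := le_concurrence_singleCoherence hs
    rw [hz] at this
    exact le_trans (by linarith) this
  have e2 : fidelity (lowFamily C) ≤ (1 + C) / 2 / 2 :=
    fidelity_singleCoherence_le le_rfl (by rw [hz]; linarith)
  have e3 := (le_max_left _ _).trans (concurrenceBound_le_fidelity hs)
  constructor <;> linarith

theorem concurrence_fidelity_highFamily {C : ℝ} (h0 : 1 / 3 ≤ C) (h1 : C ≤ 1) :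
    concurrence (highFamily C) = C ∧ fidelity (highFamily C) = C := by
  have hs := isState_highFamily h0 h1
  have hz : |-C / 2| = C / 2 := by rw [neg_div, abs_neg, abs_of_nonneg (by linarith)]
  have e1 : C ≤ concurrence (highFamily C) := by
    have := le_concurrence_singleCoherence hs
    rw [hz] at this
    exact le_trans (by linarith) this
  have e2 : fidelity (highFamily C) ≤ 2 * C / 2 :=
    fidelity_singleCoherence_le (by linarith) (by rw [hz]; linarith)
  have e3 := (le_max_right _ _).trans (concurrenceBound_le_fidelity hs)
  constructor <;> linarith

theorem fidelity_lowFamily_eq_concurrenceBound {C : ℝ} (h0 : 0 ≤ C) (h1 : C ≤ 1 / 3) :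
    fidelity (lowFamily C) = concurrenceBound (concurrence (lowFamily C)) := by
  rw [(concurrence_fidelity_lowFamily h0 h1).1, (concurrence_fidelity_lowFamily h0 h1).2,
    concurrenceBound, max_eq_left (by linarith)]

theorem fidelity_highFamily_eq_concurrenceBound {C : ℝ} (h0 : 1 / 3 ≤ C) (h1 : C ≤ 1) :
    fidelity (highFamily C) = concurrenceBound (concurrence (highFamily C)) := by
  rw [(concurrence_fidelity_highFamily h0 h1).1, (concurrence_fidelity_highFamily h0 h1).2,
    concurrenceBound, max_eq_right (by linarith)]

/-- The members of the first family have negativity `n` with `n ^ 2 + n (1 + C) = C ^ 2`: the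
coherence between `01` and `10` bounds `n` from below, and `negativityBound_le_fidelity` bounds it
from above. Hence `C` is chosen as the root `(N + √(5 N ^ 2 + 4 N)) / 2` of this equation for
`n = N`. -/
theorem exists_lowFamily_negativity {N : ℝ} (h0 : 0 ≤ N) (h1 : N ≤ (√5 - 2) / 3) :
    ∃ C : ℝ, 0 ≤ C ∧ C ≤ 1 / 3 ∧ IsState (lowFamily C) ∧ negativity (lowFamily C) = N ∧
      fidelity (lowFamily C) = 1 / 4 + (N + √(5 * N ^ 2 + 4 * N)) / 8 := by
  have h5 := Real.sq_sqrt (by norm_num : (0 : ℝ) ≤ 5)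
  have h50 := Real.sqrt_nonneg 5
  have hsq : (3 * N + 2) ^ 2 ≤ 5 := by
    rw [← h5]; exact pow_le_pow_left₀ (by linarith) (by linarith) 2
  obtain ⟨s, hs⟩ : ∃ s, s = √(5 * N ^ 2 + 4 * N) := ⟨_, rfl⟩
  have hs0 : 0 ≤ s := by rw [hs]; exact Real.sqrt_nonneg _
  have hss : s ^ 2 = 5 * N ^ 2 + 4 * N := by rw [hs]; exact Real.sq_sqrt (by positivity)
  have hs1 : s ≤ 2 / 3 - N := by
    refine abs_le_of_sq_le_sq' ?_ (by nlinarith) |>.2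
    nlinarith
  obtain ⟨C, hC⟩ : ∃ C, C = (N + s) / 2 := ⟨_, rfl⟩
  have hC0 : 0 ≤ C := by linarith
  have hC1 : C ≤ 1 / 3 := by linarith
  have hst := isState_lowFamily hC0 hC1
  have hF := (concurrence_fidelity_lowFamily hC0 hC1).2
  refine ⟨C, hC0, hC1, hst, ?_, by rw [hF, hC, ← hs]; ring⟩
  have e1 : C ^ 2 ≤ (negativity (lowFamily C) + (1 + C)) * negativity (lowFamily C) := by
    have h := sq_le_negativity_singleCoherence hst
    rw [← lowFamily_eq] at h
    linarith
  have e2 := sq_le_of_low_bound_le ((le_max_left _ _).trans (negativityBound_le_fidelity hst))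
  have hn := negativity_nonneg (lowFamily C)
  rw [hF] at e2
  set n := negativity (lowFamily C)
  have e3 : N ^ 2 + N * (1 + C) = C ^ 2 := by rw [hC]; linarith
  have e4 : (n - N) * (n + N + (1 + C)) = 0 := by linarith
  rcases mul_eq_zero.1 e4 with h | h <;> linarith

theorem exists_highFamily_negativity {N : ℝ} (h0 : (√5 - 2) / 3 ≤ N) (h1 : N ≤ 1) :
    ∃ C : ℝ, 1 / 3 ≤ C ∧ C ≤ 1 ∧ IsState (highFamily C) ∧ negativity (highFamily C) = N ∧
      fidelity (highFamily C) = √(2 * N * (N + 1)) - N := by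
  have h5 := Real.sq_sqrt (by norm_num : (0 : ℝ) ≤ 5)
  have h52 : 2 < √5 := Real.lt_sqrt_of_sq_lt (by norm_num)
  have hN : 0 < N := by linarith
  have hsq : 5 ≤ (3 * N + 2) ^ 2 := by
    rw [← h5]; exact pow_le_pow_left₀ (by linarith) (by linarith) 2
  obtain ⟨s, hs⟩ : ∃ s, s = √(2 * N * (N + 1)) := ⟨_, rfl⟩
  have hs0 : 0 ≤ s := by rw [hs]; exact Real.sqrt_nonneg _
  have hss : s ^ 2 = 2 * N * (N + 1) := by rw [hs]; exact Real.sq_sqrt (by positivity)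
  obtain ⟨C, hC⟩ : ∃ C, C = s - N := ⟨_, rfl⟩
  have hC0 : 1 / 3 ≤ C := by
    have : 1 / 3 + N ≤ s := abs_le_of_sq_le_sq' (by nlinarith) hs0 |>.2
    linarith
  have hC1 : C ≤ 1 := by
    have : s ≤ 1 + N := abs_le_of_sq_le_sq' (by nlinarith) (by linarith) |>.2
    linarith
  have hst := isState_highFamily hC0 hC1
  have hF := (concurrence_fidelity_highFamily hC0 hC1).2
  refine ⟨C, hC0, hC1, hst, ?_, by rw [hF, hC, ← hs]⟩
  have e1 : C ^ 2 ≤ (negativity (highFamily C) + 2 * (1 - C)) * negativity (highFamily C) := by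
    have h := sq_le_negativity_singleCoherence hst
    rw [← highFamily_eq] at h
    linarith
  have e2 := sq_le_of_high_bound_le ((le_max_right _ _).trans (negativityBound_le_fidelity hst))
  have hn := negativity_nonneg (highFamily C)
  rw [hF] at e2
  set n := negativity (highFamily C)
  have e3 : N ^ 2 + 2 * N * (1 - C) = C ^ 2 := by
    have : s = C + N := by linarith
    rw [this] at hss
    linarith
  have e4 : (n - N) * (n + N + 2 * (1 - C)) = 0 := by linarith
  rcases mul_eq_zero.1 e4 with h | h <;> linarith

/-- The upper bound on the fidelity is attained by mixtures of two Bell states. -/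
theorem exists_fidelity_eq_upper {N : ℝ} (h0 : 0 ≤ N) (h1 : N ≤ 1) :
    ∃ ρ : TwoQubitOp, IsState ρ ∧ negativity ρ = N ∧ fidelity ρ = (1 + N) / 2 := by
  have hst : IsState (singleCoherence 0 (1 / 2) (1 / 2) (N / 2)) :=
    isState_singleCoherence le_rfl (by norm_num) (by norm_num) (by nlinarith) (by norm_num)
  have hz : |N / 2| = N / 2 := abs_of_nonneg (by linarith)
  have hF : fidelity (singleCoherence 0 (1 / 2) (1 / 2) (N / 2)) = (1 + N) / 2 := by
    refine le_antisymm (fidelity_singleCoherence_le (by linarith) (by rw [hz]; linarith)) ?_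
    have := antiparallel_le_fidelity hst
    simp only [coherence, population, singleCoherence_apply] at this
    norm_num at this
    rw [abs_of_nonneg h0] at this
    linarith
  refine ⟨_, hst, le_antisymm (max_le h0 ?_) ?_, hF⟩
  · obtain ⟨φ, hφ1, hφ2⟩ := exists_eigenvector_minEigenvalue (isHermitian_partialTranspose hst.1.1)
    rw [← hφ2, quadraticForm_eq_sum]
    have e (w : ℂ) : (starRingEnd ℂ) w * w = ((‖w‖ : ℝ) : ℂ) ^ 2 := by
      rw [← Complex.normSq_eq_conj_mul_self, Complex.normSq_eq_norm_sq]; push_cast; rfl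
    simp only [Fintype.sum_prod_type, Fin.sum_univ_two] at hφ1
    have key : (∑ p, ∑ q, star (φ p) *
        partialTranspose (singleCoherence 0 (1 / 2) (1 / 2) (N / 2)) p q * φ q) =
        ((1 / 2 * ‖φ (0, 1)‖ ^ 2 + 1 / 2 * ‖φ (1, 0)‖ ^ 2 : ℝ) : ℂ) + ((N / 2 : ℝ) : ℂ) *
          (star (φ (0, 0)) * φ (1, 1) + star (star (φ (0, 0)) * φ (1, 1))) := by
      simp only [Complex.ofReal_add, Complex.ofReal_mul, Complex.ofReal_pow, ← e]
      simp [Fintype.sum_prod_type, Fin.sum_univ_two, partialTranspose, singleCoherence_apply]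
      ring
    have hre : (star (star (φ (0, 0)) * φ (1, 1))).re = (star (φ (0, 0)) * φ (1, 1)).re :=
      Complex.conj_re _
    rw [key, Complex.add_re, Complex.ofReal_re, Complex.re_ofReal_mul, Complex.add_re, hre]
    have hb := (abs_le.1 (Complex.abs_re_le_norm (star (φ (0, 0)) * φ (1, 1)))).1
    rw [norm_mul, norm_star] at hb
    have hsq := two_mul_le_add_sq ‖φ (0, 0)‖ ‖φ (1, 1)‖
    have h01 := sq_nonneg ‖φ (0, 1)‖
    have h10 := sq_nonneg ‖φ (1, 0)‖
    have hx : -1 ≤ 2 * (star (φ (0, 0)) * φ (1, 1)).re := by linarith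
    nlinarith [mul_le_mul_of_nonneg_left hx h0]
  · have := fidelity_le_of_negativity hst
    rw [hF] at this
    linarith

/-! ### The states of least fidelity -/

theorem minimizesFidelityForNegativity_iff {ρ : TwoQubitOp} (hρ : IsState ρ) :
    MinimizesFidelityForNegativity ρ ↔ fidelity ρ = negativityBound (negativity ρ) := by
  refine ⟨fun h => le_antisymm ?_ (negativityBound_le_fidelity hρ), fun h => ⟨hρ, fun σ hσ e => ?_⟩⟩
  · rcases le_total (negativity ρ) ((√5 - 2) / 3) with hN | hN
    · obtain ⟨C, -, -, hs, hn, hf⟩ := exists_lowFamily_negativity (negativity_nonneg ρ) hN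
      have := h.2 _ hs hn
      rw [hf] at this
      exact this.trans (le_max_left _ _)
    · obtain ⟨C, -, -, hs, hn, hf⟩ := exists_highFamily_negativity hN (negativity_le_one hρ)
      have := h.2 _ hs hn
      rw [hf] at this
      exact this.trans (le_max_right _ _)
  · rw [h, ← e]
    exact negativityBound_le_fidelity hσ

theorem minimizesFidelityForConcurrence_iff {ρ : TwoQubitOp} (hρ : IsState ρ) :
    MinimizesFidelityForConcurrence ρ ↔ fidelity ρ = concurrenceBound (concurrence ρ) := by
  refine ⟨fun h => le_antisymm ?_ (concurrenceBound_le_fidelity hρ),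
    fun h => ⟨hρ, fun σ hσ e => ?_⟩⟩
  · rcases le_total (concurrence ρ) (1 / 3) with hC | hC
    · obtain ⟨hc, hf⟩ := concurrence_fidelity_lowFamily (concurrence_nonneg ρ) hC
      have := h.2 _ (isState_lowFamily (concurrence_nonneg ρ) hC) hc
      rw [hf] at this
      exact this.trans (le_max_left _ _)
    · obtain ⟨hc, hf⟩ := concurrence_fidelity_highFamily hC (concurrence_le_one hρ)
      have := h.2 _ (isState_highFamily hC (concurrence_le_one hρ)) hc
      rw [hf] at this
      exact this.trans (le_max_right _ _)
  · rw [h, ← e]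
    exact concurrenceBound_le_fidelity hσ

theorem minimizesFidelity_localConj {ρ : TwoQubitOp} (hρ : IsState ρ)
    (h : fidelity ρ = concurrenceBound (concurrence ρ)) (U V : Matrix.unitaryGroup (Fin 2) ℂ) :
    MinimizesFidelityForConcurrence (localConj U V ρ) ∧
      MinimizesFidelityForNegativity (localConj U V ρ) := by
  have hσ := hρ.localConj U V
  have h' : fidelity (localConj U V ρ) = concurrenceBound (concurrence (localConj U V ρ)) := by
    rw [fidelity_localConj, concurrence_localConj hρ.1, h]
  exact ⟨(minimizesFidelityForConcurrence_iff hσ).2 h',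
    (minimizesFidelityForNegativity_iff hσ).2 ((fidelity_eq_negativityBound_iff hσ).2 h')⟩

theorem mainTheorem4 :
    -- the three bounds
    (∀ ρ : TwoQubitOp, IsState ρ →
      (negativity ρ ≤ (Real.sqrt 5 - 2) / 3 →
        1 / 4 + (negativity ρ + Real.sqrt (5 * negativity ρ ^ 2 + 4 * negativity ρ)) / 8
          ≤ fidelity ρ) ∧
      ((Real.sqrt 5 - 2) / 3 ≤ negativity ρ →
        Real.sqrt (2 * negativity ρ * (negativity ρ + 1)) - negativity ρ ≤ fidelity ρ) ∧
      fidelity ρ ≤ (1 + negativity ρ) / 2) ∧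
    -- sharpness of each bound, for every admissible value of the negativity; the lower bounds are
    -- attained in the two explicit families
    (∀ N : ℝ, 0 ≤ N → N ≤ (Real.sqrt 5 - 2) / 3 →
      ∃ C : ℝ, 0 ≤ C ∧ C ≤ 1 / 3 ∧ IsState (lowFamily C) ∧ negativity (lowFamily C) = N ∧
        fidelity (lowFamily C) = 1 / 4 + (N + Real.sqrt (5 * N ^ 2 + 4 * N)) / 8) ∧
    (∀ N : ℝ, (Real.sqrt 5 - 2) / 3 ≤ N → N ≤ 1 →
      ∃ C : ℝ, 1 / 3 ≤ C ∧ C ≤ 1 ∧ IsState (highFamily C) ∧ negativity (highFamily C) = N ∧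
        fidelity (highFamily C) = Real.sqrt (2 * N * (N + 1)) - N) ∧
    (∀ N : ℝ, 0 ≤ N → N ≤ 1 →
      ∃ ρ : TwoQubitOp, IsState ρ ∧ negativity ρ = N ∧ fidelity ρ = (1 + N) / 2) ∧
    -- exactly the same states minimize the fidelity for given negativity and for given concurrence
    (∀ ρ : TwoQubitOp,
      MinimizesFidelityForNegativity ρ ↔ MinimizesFidelityForConcurrence ρ) ∧
    -- the explicit families are, up to local unitaries, among these states
    (∀ (C : ℝ) (U V : Matrix.unitaryGroup (Fin 2) ℂ), 0 ≤ C → C ≤ 1 / 3 →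
      concurrence (localConj U V (lowFamily C)) = C ∧
        MinimizesFidelityForConcurrence (localConj U V (lowFamily C)) ∧
        MinimizesFidelityForNegativity (localConj U V (lowFamily C))) ∧
    (∀ (C : ℝ) (U V : Matrix.unitaryGroup (Fin 2) ℂ), 1 / 3 ≤ C → C ≤ 1 →
      concurrence (localConj U V (highFamily C)) = C ∧
        MinimizesFidelityForConcurrence (localConj U V (highFamily C)) ∧
        MinimizesFidelityForNegativity (localConj U V (highFamily C))) := by
  refine ⟨fun ρ hρ => ⟨fun _ => (le_max_left _ _).trans (negativityBound_le_fidelity hρ),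
      fun _ => (le_max_right _ _).trans (negativityBound_le_fidelity hρ),
      fidelity_le_of_negativity hρ⟩,
    fun N => exists_lowFamily_negativity, fun N => exists_highFamily_negativity,
    fun N => exists_fidelity_eq_upper, fun ρ => ?_, fun C U V h0 h1 => ?_, fun C U V h0 h1 => ?_⟩
  · constructor
    · intro h
      exact (minimizesFidelityForConcurrence_iff h.1).2 ((fidelity_eq_negativityBound_iff h.1).1
        ((minimizesFidelityForNegativity_iff h.1).1 h))
    · intro h
      exact (minimizesFidelityForNegativity_iff h.1).2 ((fidelity_eq_negativityBound_iff h.1).2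
        ((minimizesFidelityForConcurrence_iff h.1).1 h))
  · have hs := isState_lowFamily h0 h1
    rw [concurrence_localConj hs.1]
    exact ⟨(concurrence_fidelity_lowFamily h0 h1).1, minimizesFidelity_localConj hs
      (fidelity_lowFamily_eq_concurrenceBound h0 h1) U V⟩
  · have hs := isState_highFamily h0 h1
    rw [concurrence_localConj hs.1]
    exact ⟨(concurrence_fidelity_highFamily h0 h1).1, minimizesFidelity_localConj hs
      (fidelity_highFamily_eq_concurrenceBound h0 h1) U V⟩
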